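/- Equip $\mathbb{C}^n$ with $\omega=\sum_j dx_j\wedge dy_j$ and $\Omega=dz_1\wedge\dots\wedge dz_n$. Let $\mathcal{LG}^+(n)$ be the set of real $n$-dimensional linear subspaces $\Lambda\subset\mathbb{C}^n$ with $\omega|_\Lambda=0$ and $\operatorname{Re}\Omega|_\Lambda\neq 0$. For $\Lambda\in\mathcal{LG}^+(n)$ let $\operatorname{phase}(\Lambda)\in(-\frac{\pi}{2},\frac{\pi}{2})$ be the argument of $\Omega$ on any basis of $\Lambda$ on which $\operatorname{Re}\Omega>0$. For $\Lambda_0,\Lambda_1\in\mathcal{LG}^+(n)$, let $\beta_1,\dots,\beta_n\in[0,\pi)$ be the numbers $\beta$ for which $\{u\in\Lambda_0 : e^{\sqrt{-1}\beta}u\in\Lambda_1\}\neq 0$, each repeated according to the real dimension of this space. The Maslov index is \[ m(\Lambda_0,\Lambda_1)=\frac1\pi\Big(\sum_{j=1}^n\beta_j+\operatorname{phase}(\Lambda_0)-\operatorname{phase}(\Lambda_1)\Big). \] A smooth linear lifting of a path $(\Lambda_t)_{t\in[0,1]}$ in $\mathcal{LG}^+(n)$ is a family of linear isomorphisms $\Psi_t:\mathbb{R}^n\to\Lambda_t\subset\mathbb{C}^n$,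 smooth in $t\in[0,1]$; the path is smooth if it has one. The derivative of a smooth path is the family of quadratic forms $h_t$ on $\Lambda_t$ determined by $d(h_t)_{\Psi_t(x)}(\Psi_t(y))=\omega\big(\tfrac{d}{dt}\Psi_t(x),\Psi_t(y)\big)$ for $x,y\in\mathbb{R}^n$; it does not depend on the lifting. A lifting is horizontal if, for all $t\in[0,1]$ and all $x\in\mathbb{R}^n$, the contraction of $\operatorname{Re}\Omega$ with $\tfrac{d}{dt}\Psi_t(x)$ vanishes on $\Lambda_t$. A smooth path with derivative $(h_t)_t$ is a geodesic (of the positive Lagrangian connection) if $\frac{d}{dt}(h_t\circ\Psi_t)=0$ on $[0,1]$ for a horizontal lifting $(\Psi_t)_t$. **Theorem.** Let $\Lambda_0,\Lambda_1\in\mathcal{LG}^+(n)$ with $m(\Lambda_0,\Lambda_1)=0$. Then there exists a geodesic $(\Lambda_t)_{t\in[0,1]}$ in $\mathcal{LG}^+(n)$ from $\Lambda_0$ to $\Lambda_1$ whose derivative $h_t$ is negative semi-definite for every $t\in[0,1]$. If, in addition, $\Lambda_0\cap\Lambda_1=\{0\}$, then $h_t$ is negative definite for every $t\in[0,1]$.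 -/

import Mathlib

noncomputable section

namespace PosLag

open scoped ContDiff

/-- `ℂⁿ` with its standard Hermitian inner product (conjugate-linear in the first slot). -/
abbrev CSpace (n : ℕ) : Type := EuclideanSpace ℂ (Fin n)

/-- `ℝⁿ` with its standard inner product. -/
abbrev RSpace (n : ℕ) : Type := EuclideanSpace ℝ (Fin n)

/-- The standard symplectic form `∑ dxⱼ ∧ dyⱼ` on `ℂⁿ`, i.e. `∑ Im (conj uⱼ * vⱼ)`. -/
def symp {n : ℕ} (u v : CSpace n) : ℝ := (inner ℂ u v).im

/-- The standard holomorphic volume form `dz₁ ∧ ⋯ ∧ dzₙ` on `ℂⁿ`. -/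
def holVol {n : ℕ} (v : Fin n → CSpace n) : ℂ := (Matrix.of fun i j => v i j).det

/-- Real `n`-dimensional linear subspaces of `ℂⁿ` on which the symplectic form vanishes. -/
def IsLagrangian {n : ℕ} (L : Submodule ℝ (CSpace n)) : Prop :=
  Module.finrank ℝ L = n ∧ ∀ u ∈ L, ∀ v ∈ L, symp u v = 0

/-- `Re Ω` does not vanish on `L`, so that some frame of `L` is positive for `Re Ω`; equivalently
the argument of `Ω` on `L` is not `π / 2` modulo `π`. -/
def IsPositive {n : ℕ} (L : Submodule ℝ (CSpace n)) : Prop :=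
  ∃ v : Fin n → CSpace n, (∀ i, v i ∈ L) ∧ 0 < (holVol v).re

/-- The positive Lagrangian Grassmannian `LG⁺(n)`. -/
def LGPos (n : ℕ) : Type :=
  {L : Submodule ℝ (CSpace n) // IsLagrangian L ∧ IsPositive L}

/-- The linear subspace underlying a point of `LG⁺(n)`. -/
abbrev LGPos.space {n : ℕ} (L : LGPos n) : Submodule ℝ (CSpace n) := L.1

/-- The phase in `(-π/2, π/2)`: the argument of `Ω` on a frame of `L` that is positive for
`Re Ω`. It does not depend on the frame, see `phase_eq`. -/
def phase {n : ℕ} (L : LGPos n) : ℝ := Complex.arg (holVol (Classical.choose L.2.2))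

/-- On a Lagrangian subspace the values of `Ω` are real multiples of its value on a basis. -/
theorem holVol_frame {n : ℕ} (L : LGPos n) (b : Module.Basis (Fin n) ℝ L.space)
    (w : Fin n → CSpace n) (hw : ∀ i, w i ∈ L.space) :
    ∃ c : ℝ, holVol w = c * holVol (fun i => (b i : CSpace n)) := by
  let C : Matrix (Fin n) (Fin n) ℝ := Matrix.of fun i j => b.repr ⟨w i, hw i⟩ j
  refine ⟨C.det, ?_⟩
  have h1 : (Matrix.of fun i j => w i j) =
      C.map Complex.ofRealHom * (Matrix.of fun i j => (b i : CSpace n) j) := by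
    ext i k
    have h2 : (w i : CSpace n) = ∑ j, C i j • (b j : CSpace n) := by
      have h3 := congrArg Subtype.val (b.sum_repr ⟨w i, hw i⟩)
      refine h3.symm.trans ?_
      rw [AddSubmonoidClass.coe_finsetSum]
      rfl
    rw [Matrix.of_apply, h2, Matrix.mul_apply]
    simp
  have h4 : (C.map Complex.ofRealHom).det = (C.det : ℂ) :=
    (RingHom.map_det Complex.ofRealHom C).symm
  unfold holVol
  rw [h1, Matrix.det_mul, h4]

theorem phase_eq {n : ℕ} (L : LGPos n) (w : Fin n → CSpace n) (hw : ∀ i, w i ∈ L.space)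
    (hpos : 0 < (holVol w).re) : phase L = Complex.arg (holVol w) := by
  have hv := Classical.choose_spec L.2.2
  have b : Module.Basis (Fin n) ℝ L.space := Module.finBasisOfFinrankEq ℝ L.space L.2.1.1
  obtain ⟨c, hc⟩ := holVol_frame L b w hw
  obtain ⟨d, hd⟩ := holVol_frame L b _ hv.1
  have hv2 := hv.2
  unfold phase
  rw [hd] at hv2 ⊢
  rw [hc] at hpos ⊢
  rw [Complex.re_ofReal_mul] at hv2 hpos
  have hd0 : d ≠ 0 := by rintro rfl; simp at hv2
  have hcd : 0 < d / c := by
    have hc0 : c ≠ 0 := by rintro rfl; simp at hpos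
    have := mul_pos hv2 hpos
    have h5 : 0 < d * c := by
      by_contra hn
      nlinarith [mul_nonneg (neg_nonneg.2 (not_lt.1 hn)) (sq_nonneg
        (holVol (fun i => (b i : CSpace n))).re)]
    have h6 : d / c = d * c / c ^ 2 := by field_simp
    rw [h6]
    positivity
  have hc0 : c ≠ 0 := by rintro rfl; simp at hpos
  have h7 : (d : ℂ) * holVol (fun i => (b i : CSpace n)) =
      ((d / c : ℝ) : ℂ) * (c * holVol (fun i => (b i : CSpace n))) := by
    have : (c : ℂ) ≠ 0 := by exact_mod_cast hc0
    push_cast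
    field_simp
  rw [h7, Complex.arg_real_mul _ hcd]

/-- The subspace `{u ∈ L₀ | e^{iβ} u ∈ L₁}` of `L₀`: the summand belonging to the argument `β` in
the simultaneous orthogonal decomposition of a pair of Lagrangian subspaces. -/
def argSpace {n : ℕ} (L₀ L₁ : LGPos n) (β : ℝ) : Submodule ℝ (CSpace n) where
  carrier := {u | u ∈ L₀.space ∧ Complex.exp (β * Complex.I) • u ∈ L₁.space}
  add_mem' := fun ha hb =>
    ⟨L₀.space.add_mem ha.1 hb.1, by rw [smul_add]; exact L₁.space.add_mem ha.2 hb.2⟩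
  zero_mem' := ⟨L₀.space.zero_mem, by rw [smul_zero]; exact L₁.space.zero_mem⟩
  smul_mem' := fun c u hu =>
    ⟨L₀.space.smul_mem c hu.1, by rw [smul_comm]; exact L₁.space.smul_mem c hu.2⟩

/-- The Maslov index
`m(L₀, L₁) = π⁻¹ (∑ⱼ βⱼ + phase L₀ - phase L₁)`, where the `βⱼ ∈ [0, π)` are the arguments of the
pair `(L₀, L₁)`, each counted with its multiplicity `dim (argSpace L₀ L₁ βⱼ)`. -/
def maslovIndex {n : ℕ} (L₀ L₁ : LGPos n) : ℝ :=
  ((∑ᶠ (β : ℝ) (_ : β ∈ Set.Ico 0 Real.pi), (Module.finrank ℝ (argSpace L₀ L₁ β) : ℝ) * β)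
    + phase L₀ - phase L₁) / Real.pi

/-! Paths are indexed by `ℝ`, but only their restrictions to `[0, 1]` are ever used. -/

/-- A vector field along a path in `LG⁺(n)`: a quadratic form on each of the subspaces. -/
abbrev FieldAlong {n : ℕ} (L : ℝ → LGPos n) : Type :=
  ∀ t, QuadraticForm ℝ (L t).space

/-- A family of linear parameterizations of the subspaces of a path. -/
abbrev Frames {n : ℕ} (L : ℝ → LGPos n) : Type :=
  ∀ t, RSpace n ≃ₗ[ℝ] (L t).space

/-- The family of parameterizations is smooth in `t ∈ [0, 1]`, i.e. it is a smooth linear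
lifting. A path in `LG⁺(n)` is smooth on `[0, 1]` if it has such a lifting. -/
def IsLifting {n : ℕ} {L : ℝ → LGPos n} (Ψ : Frames L) : Prop :=
  ∀ x, ContDiffOn ℝ ∞ (fun t => (Ψ t x : CSpace n)) (Set.Icc 0 1)

/-- The time derivative of `Ψ t x`, one-sided at the ends of `[0, 1]`. -/
def liftDeriv {n : ℕ} {L : ℝ → LGPos n} (Ψ : Frames L) (t : ℝ) (x : RSpace n) : CSpace n :=
  derivWithin (fun s => (Ψ s x : CSpace n)) (Set.Icc 0 1) t

/-- A smooth linear lifting with `i_{dΨ/dt} Re Ω = 0` on `L t` for `t ∈ [0, 1]`. -/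
def IsHorizontalLifting {n : ℕ} {L : ℝ → LGPos n} (Ψ : Frames L) : Prop :=
  IsLifting Ψ ∧ ∀ t ∈ Set.Icc (0 : ℝ) 1, ∀ (x : RSpace n) (ξ : Fin n → RSpace n) (i : Fin n),
    (holVol (Function.update (fun j => (Ψ t (ξ j) : CSpace n)) i (liftDeriv Ψ t x))).re = 0

/-- The path `L` is smooth on `[0, 1]` and its time derivative, as a tangent vector of the
Lagrangian Grassmannian, is the quadratic form `h t`: for a smooth linear lifting `Ψ`, the
differential `d(h t)` at `Ψ t x` is the restriction of `symp (dΨ/dt x)` to `L t`. Here the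
differential of a quadratic form `q` at `u` is `QuadraticMap.polar q u`. -/
def HasDerivative {n : ℕ} (L : ℝ → LGPos n) (h : FieldAlong L) : Prop :=
  ∃ Ψ : Frames L, IsLifting Ψ ∧ ∀ t ∈ Set.Icc (0 : ℝ) 1, ∀ x y : RSpace n,
    QuadraticMap.polar (h t) (Ψ t x) (Ψ t y) = symp (liftDeriv Ψ t x) (Ψ t y)

/-- The field `k` is the covariant derivative of the field `h` along `L` for the positive
Lagrangian connection: `k t ∘ Ψ t` is the time derivative of `h t ∘ Ψ t` for a horizontal lifting
`Ψ`. -/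
def HasCovariantDerivative {n : ℕ} (L : ℝ → LGPos n) (h k : FieldAlong L) : Prop :=
  ∃ Ψ : Frames L, IsHorizontalLifting Ψ ∧ ∀ t ∈ Set.Icc (0 : ℝ) 1, ∀ x : RSpace n,
    HasDerivWithinAt (fun s => h s (Ψ s x)) (k t (Ψ t x)) (Set.Icc 0 1) t

/-- `L` restricted to `[0, 1]` is a geodesic of the positive Lagrangian connection with
derivative `h`. -/
def IsGeodesic {n : ℕ} (L : ℝ → LGPos n) (h : FieldAlong L) : Prop :=
  HasDerivative L h ∧ HasCovariantDerivative L h (fun _ => 0)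

end PosLag

end

noncomputable section

namespace PosLag

open scoped ContDiff Topology
open Set Filter

/-! ### The shifted root of a product of linear factors -/

section Root

variable {ι : Type*} [Fintype ι]

/-! A unitary basis `u` of `L₀` can be chosen with `e^{iβⱼ} uⱼ ∈ L₁` and `βⱼ ∈ [0, π)`
(`exists_common_frame`), and vanishing of the Maslov index says that the phase of `L₁` is the phase
of `L₀` plus `∑ βⱼ`. So one looks for a geodesic spanned by `e^{iαⱼ(t)} uⱼ`, with lifting `eⱼ ↦ rⱼ
e^{iαⱼ} uⱼ` and phase `θ = θ₀ + ∑ αⱼ`. Horizontality becomes `rⱼ' / rⱼ = αⱼ' tan θ`, and the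
geodesic equation says that `κⱼ = rⱼ² αⱼ'` is constant. The derivative is then `-½ ∑ κⱼ xⱼ²` in this
frame, so its sign is that of `-κ`.

Taking all `κⱼ` equal, the `rⱼ²` have a common derivative, so `rⱼ² = s + cⱼ`. Moreover `∏ rⱼ²` is
proportional to `1 + tan² θ`. With `x = tan θ` as parameter, `s = prodRoot c x`, and `dαⱼ =
rootWeight c j x dx / (1 + x²)`. What remains is to find `c` for which these integrals equal the
`βⱼ`.

Since `-rootWeight` is the gradient of the convex function `prodRoot` in `c`, this is the critical
point equation of the convex `angleFunctional`. That functional is invariant under adding a constant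
to `c`, because `∑ βⱼ` is the increment of `arctan`, and coercive modulo this shift when all `βⱼ >
0`; so it has a minimum (`exists_integral_rootWeight_eq`). A change of time then gives the geodesic
(`exists_diagonalGeodesic_of_pos`). Directions with `βⱼ = 0` stay fixed, with `κⱼ = 0`; they are
absent if `L₀ ∩ L₁ = 0`. -/

theorem exists_prodRoot [Nonempty ι] (c : ι → ℝ) {ρ : ℝ} (hρ : 0 < ρ) :
    ∃ s : ℝ, (∀ j, 0 < s + c j) ∧ ∏ j, (s + c j) = ρ := by
  obtain ⟨j₀, hj₀⟩ := Finite.exists_min c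
  -- At the left end one factor vanishes; at the right end every factor is at least `1 + ρ`.
  have hle : -c j₀ ≤ -c j₀ + (1 + ρ) := by linarith
  have hcont : ContinuousOn (fun s => ∏ j, (s + c j)) (Icc (-c j₀) (-c j₀ + (1 + ρ))) := by
    fun_prop
  have h0 : ∏ j, (-c j₀ + c j) = 0 :=
    Finset.prod_eq_zero (Finset.mem_univ j₀) (by ring)
  have h1 : ρ ≤ ∏ j, (-c j₀ + (1 + ρ) + c j) := by
    calc ρ ≤ (1 + ρ) := by linarith
      _ ≤ (1 + ρ) ^ Fintype.card ι :=
        le_self_pow₀ (by linarith) Fintype.card_ne_zero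
      _ = ∏ _j : ι, (1 + ρ) := by simp
      _ ≤ _ := Finset.prod_le_prod (fun _ _ => by linarith) (fun j _ => by
        have := hj₀ j; linarith)
  obtain ⟨s, hs, hsρ⟩ := intermediate_value_Icc hle hcont ⟨by simpa [h0] using hρ.le, h1⟩
  refine ⟨s, fun j => ?_, hsρ⟩
  rcases hs.1.lt_or_eq with h | h
  · have := hj₀ j; linarith
  · exfalso
    have hsρ' : ∏ j, (s + c j) = ρ := hsρ
    rw [← h, h0] at hsρ'
    exact hρ.ne hsρ'

/-- The root `s > -min c` of `∏ (s + c j) = 1 + x ^ 2`. -/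
def prodRoot [Nonempty ι] (c : ι → ℝ) (x : ℝ) : ℝ :=
  (exists_prodRoot c (show 0 < 1 + x ^ 2 by positivity)).choose

variable [Nonempty ι]

theorem prodRoot_pos (c : ι → ℝ) (x : ℝ) (j : ι) : 0 < prodRoot c x + c j :=
  (exists_prodRoot c (show 0 < 1 + x ^ 2 by positivity)).choose_spec.1 j

theorem prod_prodRoot (c : ι → ℝ) (x : ℝ) : ∏ j, (prodRoot c x + c j) = 1 + x ^ 2 :=
  (exists_prodRoot c (show 0 < 1 + x ^ 2 by positivity)).choose_spec.2

theorem prod_lt_prod_shift {c : ι → ℝ} {s s' : ℝ} (hs : ∀ j, 0 < s + c j) (h : s < s') :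
    ∏ j, (s + c j) < ∏ j, (s' + c j) :=
  Finset.prod_lt_prod_of_nonempty (fun j _ => hs j) (fun j _ => by linarith)
    Finset.univ_nonempty

theorem prodRoot_lt {c : ι → ℝ} {x s : ℝ} (hs : ∀ j, 0 < s + c j)
    (h : 1 + x ^ 2 < ∏ j, (s + c j)) : prodRoot c x < s := by
  by_contra! hle
  rcases hle.lt_or_eq with h1 | h1
  · have := prod_lt_prod_shift hs h1
    rw [prod_prodRoot] at this
    linarith
  · rw [h1, prod_prodRoot] at h
    exact lt_irrefl _ h

theorem lt_prodRoot {c : ι → ℝ} {x s : ℝ} (h : ∏ j, (s + c j) < 1 + x ^ 2) :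
    s < prodRoot c x := by
  by_contra! hle
  rcases hle.lt_or_eq with h1 | h1
  · have := prod_lt_prod_shift (prodRoot_pos c x) h1
    rw [prod_prodRoot] at this
    linarith
  · rw [← h1, prod_prodRoot] at h
    exact lt_irrefl _ h

theorem prodRoot_eq {c : ι → ℝ} {x s : ℝ} (hs : ∀ j, 0 < s + c j)
    (h : ∏ j, (s + c j) = 1 + x ^ 2) : prodRoot c x = s := by
  rcases lt_trichotomy (prodRoot c x) s with h1 | h1 | h1
  · have := prod_lt_prod_shift (prodRoot_pos c x) h1
    rw [prod_prodRoot] at this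
    linarith
  · exact h1
  · have := prod_lt_prod_shift hs h1
    rw [prod_prodRoot] at this
    linarith

theorem prodRoot_sub (c : ι → ℝ) (x m : ℝ) :
    prodRoot (fun j => c j - m) x = prodRoot c x + m := by
  refine prodRoot_eq (fun j => ?_) ?_
  · have := prodRoot_pos c x j
    linarith
  · rw [← prod_prodRoot c x]
    exact Finset.prod_congr rfl fun j _ => by ring

/-- The product increases strictly with `s` where its factors are positive, so bounds on the root
amount to strict inequalities between products, which persist under small changes of `c` and `x`. -/
theorem continuous_prodRoot :
    Continuous fun q : (ι → ℝ) × ℝ => prodRoot q.1 q.2 := by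
  rw [continuous_iff_continuousAt]
  rintro ⟨c, x⟩
  rw [ContinuousAt, tendsto_order]
  have key : ∀ a, Tendsto (fun q : (ι → ℝ) × ℝ => ∏ j, (a + q.1 j)) (𝓝 (c, x))
      (𝓝 (∏ j, (a + c j))) := fun a =>
    (show Continuous fun q : (ι → ℝ) × ℝ => ∏ j, (a + q.1 j) by fun_prop).continuousAt
  have key2 : Tendsto (fun q : (ι → ℝ) × ℝ => 1 + q.2 ^ 2) (𝓝 (c, x)) (𝓝 (1 + x ^ 2)) :=
    (show Continuous fun q : (ι → ℝ) × ℝ => 1 + q.2 ^ 2 by fun_prop).continuousAt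
  have key3 : ∀ a, (∀ j, 0 < a + c j) →
      ∀ᶠ q : (ι → ℝ) × ℝ in 𝓝 (c, x), ∀ j, 0 < a + q.1 j := fun a ha => by
    rw [eventually_all]
    intro j
    exact (show Continuous fun q : (ι → ℝ) × ℝ => a + q.1 j by fun_prop).continuousAt.eventually
      (lt_mem_nhds (ha j))
  constructor
  · intro a ha
    obtain ⟨j₀, hj₀⟩ := Finite.exists_min c
    have h0 : max a (-c j₀) < prodRoot c x :=
      max_lt ha (by have := prodRoot_pos c x j₀; linarith)
    obtain ⟨b, hb, hbs⟩ := exists_between h0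
    have hbc : ∀ j, 0 < b + c j := fun j => by
      have := hj₀ j
      have := (le_max_right a (-c j₀)).trans_lt hb
      linarith
    have hlt := prod_lt_prod_shift hbc hbs
    rw [prod_prodRoot] at hlt
    filter_upwards [(key b).eventually_lt key2 hlt] with q h1
    exact ((le_max_left a _).trans_lt hb).trans (lt_prodRoot h1)
  · intro a ha
    have hac : ∀ j, 0 < a + c j := fun j => by
      have := prodRoot_pos c x j
      linarith
    have hlt := prod_lt_prod_shift (prodRoot_pos c x) ha
    rw [prod_prodRoot] at hlt
    filter_upwards [key2.eventually_lt (key a) hlt, key3 a hac] with q h1 h2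
    exact prodRoot_lt h2 h1

/-- The sum of the reciprocals of the factors `s + c j` at the root `s`. -/
def recipSum (c : ι → ℝ) (x : ℝ) : ℝ := ∑ k, (prodRoot c x + c k)⁻¹

theorem recipSum_pos (c : ι → ℝ) (x : ℝ) : 0 < recipSum c x :=
  Finset.sum_pos (fun k _ => inv_pos.2 (prodRoot_pos c x k)) Finset.univ_nonempty

/-- The normalized reciprocals of the factors; minus the gradient of the root in `c`. -/
def rootWeight (c : ι → ℝ) (j : ι) (x : ℝ) : ℝ := (prodRoot c x + c j)⁻¹ / recipSum c x

theorem sum_rootWeight (c : ι → ℝ) (x : ℝ) : ∑ j, rootWeight c j x = 1 := by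
  unfold rootWeight
  rw [← Finset.sum_div]
  exact div_self (recipSum_pos c x).ne'

theorem continuous_recipSum : Continuous fun q : (ι → ℝ) × ℝ => recipSum q.1 q.2 := by
  refine continuous_finsetSum _ fun k _ => Continuous.inv₀ ?_ fun q => (prodRoot_pos _ _ _).ne'
  exact continuous_prodRoot.add (by fun_prop)

theorem continuous_rootWeight (j : ι) :
    Continuous fun q : (ι → ℝ) × ℝ => rootWeight q.1 j q.2 := by
  refine Continuous.div (Continuous.inv₀ ?_ fun q => (prodRoot_pos _ _ _).ne')
    continuous_recipSum fun q => (recipSum_pos _ _).ne'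
  exact continuous_prodRoot.add (by fun_prop)

/-- Convexity of the root in `c`, in the form of a tangent inequality. -/
theorem prodRoot_tangent_le (c c' : ι → ℝ) (x : ℝ) :
    prodRoot c' x + ∑ k, rootWeight c' k x * (c' k - c k) ≤ prodRoot c x := by
  -- Both products equal `1 + x²`, so the logarithms of the ratios sum to zero; `log y ≤ y - 1` then
  -- bounds a sum that is the desired gap times `recipSum c' x`.
  have h1 : ∑ k, Real.log ((prodRoot c x + c k) / (prodRoot c' x + c' k)) = 0 := by
    rw [← Real.log_prod fun k _ => (div_pos (prodRoot_pos c x k) (prodRoot_pos c' x k)).ne',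
      Finset.prod_div_distrib, prod_prodRoot, prod_prodRoot, div_self (by positivity),
      Real.log_one]
  have h2 : 0 ≤ ∑ k, ((prodRoot c x + c k) / (prodRoot c' x + c' k) - 1) := by
    rw [← h1]
    exact Finset.sum_le_sum fun k _ => Real.log_le_sub_one_of_pos
      (div_pos (prodRoot_pos c x k) (prodRoot_pos c' x k))
  have h3 : ∑ k, ((prodRoot c x + c k) / (prodRoot c' x + c' k) - 1) =
      (prodRoot c x - prodRoot c' x - ∑ k, rootWeight c' k x * (c' k - c k)) *
        recipSum c' x := by
    have h4 : (∑ k, rootWeight c' k x * (c' k - c k)) * recipSum c' x =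
        ∑ k, (prodRoot c' x + c' k)⁻¹ * (c' k - c k) := by
      rw [Finset.sum_mul]
      refine Finset.sum_congr rfl fun k _ => ?_
      unfold rootWeight
      have := (recipSum_pos c' x).ne'
      field_simp
    rw [sub_mul, h4, recipSum, Finset.mul_sum, ← Finset.sum_sub_distrib]
    refine Finset.sum_congr rfl fun k _ => ?_
    have := (prodRoot_pos c' x k).ne'
    field_simp
    ring
  rw [h3] at h2
  have := nonneg_of_mul_nonneg_left h2 (recipSum_pos c' x)
  linarith

end Root

/-! ### The boundary value problem for the angles -/

section Minimize

variable {ι : Type*} [Fintype ι] [Nonempty ι]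

theorem continuous_integral_div_one_add_sq {X : Type*} [TopologicalSpace X]
    {f : X × ℝ → ℝ} (hf : Continuous f) (a b : ℝ) :
    Continuous fun y => ∫ x in a..b, f (y, x) / (1 + x ^ 2) := by
  refine intervalIntegral.continuous_parametric_intervalIntegral_of_continuous' ?_ a b
  refine Continuous.div (by simpa [Function.uncurry_def] using hf) (by fun_prop) fun q => ?_
  positivity

theorem intervalIntegrable_div_one_add_sq {f : ℝ → ℝ} (hf : Continuous f) (a b : ℝ) :
    IntervalIntegrable (fun x => f x / (1 + x ^ 2)) MeasureTheory.volume a b := by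
  refine Continuous.intervalIntegrable (Continuous.div hf (by fun_prop) fun x => ?_) a b
  positivity

theorem continuous_prodRoot_right (c : ι → ℝ) : Continuous (prodRoot c) :=
  continuous_prodRoot.comp (Continuous.prodMk_right c)

theorem continuous_rootWeight_right (c : ι → ℝ) (j : ι) : Continuous (rootWeight c j) :=
  (continuous_rootWeight j).comp (Continuous.prodMk_right c)

/-- The convex functional whose critical points solve the boundary value problem. -/
def angleFunctional (β : ι → ℝ) (a b : ℝ) (c : ι → ℝ) : ℝ :=
  (∫ x in a..b, prodRoot c x / (1 + x ^ 2)) + ∑ j, β j * c j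

theorem continuous_angleFunctional (β : ι → ℝ) (a b : ℝ) :
    Continuous (angleFunctional β a b) :=
  (continuous_integral_div_one_add_sq continuous_prodRoot a b).add (by fun_prop)

/-- The shift raises the root by `m`, hence the integral by `m (arctan b - arctan a)`, which the
linear term loses by `hβ`. -/
theorem angleFunctional_sub (β : ι → ℝ) (a b : ℝ)
    (hβ : ∑ j, β j = Real.arctan b - Real.arctan a) (c : ι → ℝ) (m : ℝ) :
    angleFunctional β a b (fun j => c j - m) = angleFunctional β a b c := by
  unfold angleFunctional
  have h1 : ∫ x in a..b, prodRoot (fun j => c j - m) x / (1 + x ^ 2) =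
      (∫ x in a..b, prodRoot c x / (1 + x ^ 2)) + m * (Real.arctan b - Real.arctan a) := by
    rw [← integral_one_div_one_add_sq, ← intervalIntegral.integral_const_mul,
      ← intervalIntegral.integral_add
        (intervalIntegrable_div_one_add_sq (continuous_prodRoot_right c) a b)
        ((intervalIntegrable_div_one_add_sq continuous_const a b).const_mul m)]
    refine intervalIntegral.integral_congr fun x _ => ?_
    simp only [prodRoot_sub]
    ring
  rw [h1, ← hβ]
  simp only [mul_sub, Finset.sum_sub_distrib, ← Finset.sum_mul]
  ring

theorem le_angleFunctional {β : ι → ℝ} {a b : ℝ} (hab : a ≤ b) {c : ι → ℝ} {j₀ : ι}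
    (h0 : c j₀ = 0) : ∑ j, β j * c j ≤ angleFunctional β a b c := by
  unfold angleFunctional
  have : 0 ≤ ∫ x in a..b, prodRoot c x / (1 + x ^ 2) := by
    refine intervalIntegral.integral_nonneg hab fun x _ => ?_
    have := prodRoot_pos c x j₀
    rw [h0, add_zero] at this
    positivity
  linarith

theorem exists_angleFunctional_min {β : ι → ℝ} {a b : ℝ} (hab : a ≤ b) (hpos : ∀ j, 0 < β j)
    (hβ : ∑ j, β j = Real.arctan b - Real.arctan a) :
    ∃ c, ∀ c', angleFunctional β a b c ≤ angleFunctional β a b c' := by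
  set G := angleFunctional β a b with hG
  have hG0 : 0 ≤ G 0 := by
    simpa using le_angleFunctional (β := β) hab (c := 0) (j₀ := Classical.arbitrary ι) rfl
  -- By shift invariance only `c'` with minimum `0` matter. There the functional is at least `∑ βⱼ
  -- c'ⱼ`, which exceeds `G 0` outside this box.
  obtain ⟨c, -, hc⟩ := (isCompact_univ_pi (s := fun j => Icc 0 (G 0 / β j))
    fun j => isCompact_Icc).exists_isMinOn ⟨0, fun j _ => ⟨le_rfl, div_nonneg hG0 (hpos j).le⟩⟩
    (continuous_angleFunctional β a b).continuousOn
  refine ⟨c, fun c' => ?_⟩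
  obtain ⟨j₀, hj₀⟩ := Finite.exists_min c'
  rw [hG, ← angleFunctional_sub β a b hβ c' (c' j₀)]
  by_cases hmem : (fun j => c' j - c' j₀) ∈ univ.pi fun j => Icc 0 (G 0 / β j)
  · exact hc hmem
  · have h0 : G c ≤ G 0 := hc fun j _ => ⟨le_rfl, div_nonneg hG0 (hpos j).le⟩
    refine h0.trans (le_trans ?_ (le_angleFunctional hab (j₀ := j₀) (sub_self _)))
    simp only [mem_univ_pi, not_forall, mem_Icc, not_and, not_le] at hmem
    obtain ⟨j, hj⟩ := hmem
    have hj := hj (sub_nonneg.2 (hj₀ j))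
    rw [div_lt_iff₀ (hpos j)] at hj
    calc G 0 ≤ β j * (c' j - c' j₀) := by linarith
      _ ≤ _ := Finset.single_le_sum (f := fun j => β j * (c' j - c' j₀))
        (fun k _ => mul_nonneg (hpos k).le (sub_nonneg.2 (hj₀ k))) (Finset.mem_univ j)

/-- Increase `c j` by `ε > 0` and use the tangent inequality at the perturbed point; letting `ε → 0`
needs only continuity of the weights, no differentiation under the integral. -/
theorem integral_rootWeight_le_of_min {β : ι → ℝ} {a b : ℝ} (hab : a ≤ b) {c : ι → ℝ}
    (hc : ∀ c', angleFunctional β a b c ≤ angleFunctional β a b c') (j : ι) :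
    ∫ x in a..b, rootWeight c j x / (1 + x ^ 2) ≤ β j := by
  classical
  set e : ℝ → ι → ℝ := fun ε => c + Pi.single j ε with he
  have hcont : Continuous e :=
    continuous_const.add (continuous_single (A := fun _ : ι => ℝ) j)
  have he0 : e 0 = c := by simp [he]
  have hlim : Tendsto (fun ε => ∫ x in a..b, rootWeight (e ε) j x / (1 + x ^ 2)) (𝓝[>] 0)
      (𝓝 (∫ x in a..b, rootWeight c j x / (1 + x ^ 2))) := by
    have := ((continuous_integral_div_one_add_sq (continuous_rootWeight j) a b).comp
      hcont).tendsto 0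
    simp only [Function.comp_def, he0] at this
    exact this.mono_left nhdsWithin_le_nhds
  refine le_of_tendsto hlim ?_
  filter_upwards [self_mem_nhdsWithin] with ε hε
  have hε : 0 < ε := hε
  have h1 := hc (e ε)
  unfold angleFunctional at h1
  have hsum : ∑ k, β k * e ε k = ∑ k, β k * c k + ε * β j := by
    simp [he, mul_add, Finset.sum_add_distrib, Pi.single_apply, mul_comm]
  have h2 : ∫ x in a..b, (prodRoot (e ε) x / (1 + x ^ 2) + ε * (rootWeight (e ε) j x /
      (1 + x ^ 2))) ≤ ∫ x in a..b, prodRoot c x / (1 + x ^ 2) := by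
    refine intervalIntegral.integral_mono_on hab
      ((intervalIntegrable_div_one_add_sq (continuous_prodRoot_right _) a b).add
        ((intervalIntegrable_div_one_add_sq (continuous_rootWeight_right _ j) a b).const_mul ε))
      (intervalIntegrable_div_one_add_sq (continuous_prodRoot_right _) a b) fun x _ => ?_
    have h3 := prodRoot_tangent_le c (e ε) x
    have h4 : ∑ k, rootWeight (e ε) k x * (e ε k - c k) = rootWeight (e ε) j x * ε := by
      simp [he, Pi.single_apply]
    rw [h4] at h3
    calc _ = (prodRoot (e ε) x + rootWeight (e ε) j x * ε) / (1 + x ^ 2) := by ring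
      _ ≤ _ := by gcongr
  rw [intervalIntegral.integral_add
    (intervalIntegrable_div_one_add_sq (continuous_prodRoot_right _) a b)
    ((intervalIntegrable_div_one_add_sq (continuous_rootWeight_right _ j) a b).const_mul ε),
    intervalIntegral.integral_const_mul] at h2
  rw [hsum] at h1
  have h5 : ε * ∫ x in a..b, rootWeight (e ε) j x / (1 + x ^ 2) ≤ ε * β j := by linarith
  exact le_of_mul_le_mul_left h5 hε

theorem sum_integral_rootWeight (c : ι → ℝ) (a b : ℝ) :
    ∑ j, ∫ x in a..b, rootWeight c j x / (1 + x ^ 2) = Real.arctan b - Real.arctan a := by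
  rw [← intervalIntegral.integral_finsetSum fun j _ =>
    intervalIntegrable_div_one_add_sq (continuous_rootWeight_right c j) a b,
    ← integral_one_div_one_add_sq]
  refine intervalIntegral.integral_congr fun x _ => ?_
  simp only [← Finset.sum_div, sum_rootWeight]

/-- At a minimum each integral is at most `β j`; both sides have the same total over `j`, so all the
inequalities are equalities. -/
theorem exists_integral_rootWeight_eq {β : ι → ℝ} {a b : ℝ} (hab : a ≤ b)
    (hpos : ∀ j, 0 < β j) (hβ : ∑ j, β j = Real.arctan b - Real.arctan a) :
    ∃ c : ι → ℝ, ∀ j, ∫ x in a..b, rootWeight c j x / (1 + x ^ 2) = β j := by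
  obtain ⟨c, hc⟩ := exists_angleFunctional_min hab hpos hβ
  refine ⟨c, fun j => ?_⟩
  refine (Finset.sum_eq_sum_iff_of_le fun j _ => integral_rootWeight_le_of_min hab hc j).1 ?_ j
    (Finset.mem_univ j)
  rw [sum_integral_rootWeight, hβ]

end Minimize

/-! ### Smooth dependence on the parameter, and solution of the diagonal geodesic equations -/

section Smooth

/-- Continuity keeps `g` within the domain of the local inverse of `f`, so near `y` it is that
inverse composed with `k`. The version within a set serves the ends of `[0, 1]`. -/
theorem contDiffWithinAt_of_comp_eq {f g k : ℝ → ℝ} {S : Set ℝ} {y f' : ℝ}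
    (hf : ContDiffAt ℝ ∞ f (g y)) (hf' : HasDerivAt f f' (g y)) (h0 : f' ≠ 0)
    (hk : ContDiffWithinAt ℝ ∞ k S y)
    (hg : ContinuousWithinAt g S y) (hy : y ∈ S) (hfg : ∀ z ∈ S, f (g z) = k z) :
    ContDiffWithinAt ℝ ∞ g S y := by
  have hF : HasFDerivAt f
      ((ContinuousLinearEquiv.unitsEquivAut ℝ (Units.mk0 f' h0) : ℝ ≃L[ℝ] ℝ) : ℝ →L[ℝ] ℝ)
      (g y) := by
    refine hf'.hasFDerivAt.congr_fderiv ?_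
    ext
    simp
  have h1 := hf.to_localInverse hF (by simp)
  rw [hfg y hy] at h1
  have h2 := (hf.hasStrictFDerivAt' hF (by simp)).eventually_left_inverse
  refine (h1.comp_contDiffWithinAt y hk).congr_of_eventuallyEq ?_ ?_
  · filter_upwards [hg.eventually h2, self_mem_nhdsWithin] with z hz hzS
    rw [hfg z hzS] at hz
    exact hz.symm
  · have h3 := h2.self_of_nhds
    rw [hfg y hy] at h3
    exact h3.symm

theorem hasDerivWithinAt_of_comp_eq {f g k : ℝ → ℝ} {S : Set ℝ} {y f' k' : ℝ}
    (hf' : HasDerivAt f f' (g y)) (h0 : f' ≠ 0) (hk : HasDerivWithinAt k k' S y)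
    (hg : DifferentiableWithinAt ℝ g S y) (hy : y ∈ S) (hS : UniqueDiffWithinAt ℝ S y)
    (hfg : ∀ z ∈ S, f (g z) = k z) :
    HasDerivWithinAt g (k' / f') S y := by
  have h1 := hf'.comp_hasDerivWithinAt y hg.hasDerivWithinAt
  have h2 : HasDerivWithinAt (f ∘ g) k' S y := hk.congr (fun z hz => hfg z hz) (hfg y hy)
  have h3 := hS.eq_deriv _ h1 h2
  refine hg.hasDerivWithinAt.congr_deriv ?_
  rw [← h3, mul_div_cancel_left₀ _ h0]

theorem hasDerivAt_log_prod {ι : Type*} [Fintype ι] {c : ι → ℝ} {s : ℝ}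
    (hs : ∀ j, 0 < s + c j) :
    HasDerivAt (fun s => ∑ j, Real.log (s + c j)) (∑ j, (s + c j)⁻¹) s := by
  refine HasDerivAt.fun_sum fun j _ => ?_
  simpa using ((hasDerivAt_id s).add_const (c j)).log (hs j).ne'

variable {ι : Type*} [Fintype ι] [Nonempty ι]

theorem sum_log_prodRoot (c : ι → ℝ) (x : ℝ) :
    ∑ j, Real.log (prodRoot c x + c j) = Real.log (1 + x ^ 2) := by
  rw [← Real.log_prod fun j _ => (prodRoot_pos c x j).ne', prod_prodRoot]

theorem contDiff_prodRoot (c : ι → ℝ) : ContDiff ℝ ∞ (prodRoot c) := by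
  rw [← contDiffOn_univ]
  intro x hx
  refine contDiffWithinAt_of_comp_eq (f := fun s => ∑ j, Real.log (s + c j))
    (k := fun x => Real.log (1 + x ^ 2)) ?_ (hasDerivAt_log_prod (prodRoot_pos c x))
    (recipSum_pos c x).ne' ?_ (continuous_prodRoot_right c).continuousWithinAt hx
    fun z _ => sum_log_prodRoot c z
  · exact ContDiffAt.sum fun j _ => (contDiffAt_id.add contDiffAt_const).log
      (prodRoot_pos c x j).ne'
  · exact ContDiffWithinAt.log (by fun_prop) (by positivity)

theorem hasDerivAt_prodRoot (c : ι → ℝ) (x : ℝ) :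
    HasDerivAt (prodRoot c) (2 * x / (1 + x ^ 2) / recipSum c x) x := by
  rw [← hasDerivWithinAt_univ]
  refine hasDerivWithinAt_of_comp_eq (hasDerivAt_log_prod (prodRoot_pos c x))
    (recipSum_pos c x).ne' ?_
    ((contDiff_prodRoot c).differentiable (by simp) x).differentiableWithinAt (mem_univ x)
    uniqueDiffWithinAt_univ fun z _ => sum_log_prodRoot c z
  have := ((hasDerivAt_pow 2 x).const_add 1).log (by positivity)
  rw [hasDerivWithinAt_univ]
  simpa using this

theorem contDiff_recipSum (c : ι → ℝ) : ContDiff ℝ ∞ (recipSum c) :=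
  ContDiff.sum fun k _ => ((contDiff_prodRoot c).add contDiff_const).inv
    fun x => (prodRoot_pos c x k).ne'

theorem contDiff_rootWeight (c : ι → ℝ) (j : ι) : ContDiff ℝ ∞ (rootWeight c j) :=
  (((contDiff_prodRoot c).add contDiff_const).inv fun x => (prodRoot_pos c x j).ne').div
    (contDiff_recipSum c) fun x => (recipSum_pos c x).ne'

theorem hasDerivAt_integral_of_contDiff {f : ℝ → ℝ} (hf : ContDiff ℝ ∞ f) (a x : ℝ) :
    HasDerivAt (fun x => ∫ y in a..x, f y) (f x) x :=
  intervalIntegral.integral_hasDerivAt_right (hf.continuous.intervalIntegrable a x)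
    (hf.continuous.stronglyMeasurableAtFilter _ _) hf.continuous.continuousAt

theorem contDiff_integral {f : ℝ → ℝ} (hf : ContDiff ℝ ∞ f) (a : ℝ) :
    ContDiff ℝ ∞ fun x => ∫ y in a..x, f y := by
  rw [contDiff_infty_iff_deriv]
  refine ⟨fun x => (hasDerivAt_integral_of_contDiff hf a x).differentiableAt, ?_⟩
  rwa [funext fun x => (hasDerivAt_integral_of_contDiff hf a x).deriv]

/-- A primitive of a positive smooth function between two points, rescaled to `[0, 1]`, has a
smooth inverse. -/
theorem exists_smooth_time_change {D : ℝ → ℝ} (hD : ContDiff ℝ ∞ D) (hpos : ∀ x, 0 < D x)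
    {a b : ℝ} (hab : a < b) :
    ∃ (T : ℝ) (ξ : ℝ → ℝ), 0 < T ∧ ξ 0 = a ∧ ξ 1 = b ∧ ContDiffOn ℝ ∞ ξ (Icc 0 1) ∧
      ∀ t ∈ Icc (0 : ℝ) 1, HasDerivWithinAt ξ (T / D (ξ t)) (Icc 0 1) t := by
  set τ : ℝ → ℝ := fun x => ∫ y in a..x, D y with hτ
  have hτ' : ∀ x, HasDerivAt τ (D x) x := hasDerivAt_integral_of_contDiff hD a
  have hmono : StrictMono τ := strictMono_of_hasDerivAt_pos hτ' hpos
  have hτa : τ a = 0 := by simp [hτ]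
  have hT : 0 < τ b := hτa ▸ hmono hab
  have hτc : ContDiff ℝ ∞ τ := contDiff_integral hD a
  have hex : ∀ t : Icc (0 : ℝ) 1, ∃ x, τ x = τ b * t := fun t => by
    obtain ⟨x, -, hx⟩ := intermediate_value_Icc hab.le hτc.continuous.continuousOn
      (show τ b * t ∈ Icc (τ a) (τ b) by
        rw [hτa]
        exact ⟨mul_nonneg hT.le t.2.1, mul_le_of_le_one_right hT.le t.2.2⟩)
    exact ⟨x, hx⟩
  choose φ hφ using hex
  -- The projection only supplies values outside `[0, 1]`.
  set ξ : ℝ → ℝ := fun t => φ (projIcc 0 1 zero_le_one t) with hξ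
  have hξτ : ∀ t ∈ Icc (0 : ℝ) 1, τ (ξ t) = τ b * t := fun t ht => by
    rw [hξ]
    simp only [hφ, projIcc_of_mem _ ht]
  have hcont : ∀ t ∈ Icc (0 : ℝ) 1, ContinuousWithinAt ξ (Icc 0 1) t := fun t ht => by
    rw [ContinuousWithinAt, tendsto_order]
    have hlim : Tendsto (fun z => τ b * z) (𝓝[Icc 0 1] t) (𝓝 (τ (ξ t))) := by
      rw [hξτ t ht]
      exact (continuous_const.mul continuous_id).continuousWithinAt
    constructor <;> intro y hy
    · filter_upwards [hlim.eventually (lt_mem_nhds (hmono hy)), self_mem_nhdsWithin]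
        with z hz hzS
      rwa [← hξτ z hzS, hmono.lt_iff_lt] at hz
    · filter_upwards [hlim.eventually (gt_mem_nhds (hmono hy)), self_mem_nhdsWithin]
        with z hz hzS
      rwa [← hξτ z hzS, hmono.lt_iff_lt] at hz
  have hsmooth : ContDiffOn ℝ ∞ ξ (Icc 0 1) := fun t ht =>
    contDiffWithinAt_of_comp_eq hτc.contDiffAt (hτ' _) (hpos _).ne'
      (contDiffWithinAt_const.mul contDiffWithinAt_id) (hcont t ht) ht hξτ
  refine ⟨τ b, ξ, hT, hmono.injective ?_, hmono.injective ?_, hsmooth, fun t ht => ?_⟩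
  · rw [hξτ 0 (by simp), hτa, mul_zero]
  · rw [hξτ 1 (by simp), mul_one]
  · refine hasDerivWithinAt_of_comp_eq (hτ' _) (hpos _).ne' ?_
      (hsmooth.differentiableOn (by simp) t ht) ht (uniqueDiffOn_Icc zero_lt_one t ht) hξτ
    simpa using (hasDerivWithinAt_id t (Icc (0 : ℝ) 1)).const_mul (τ b)

/-- The data of a geodesic of diagonal form: angles `α j` and radii `r j` on `[0, 1]`, such that
the phase is `θ₀ + ∑ α j`, the quantities `r j ^ 2 * (α j)'` are constants `κ j`, and
`(r j)' = r j * (α j)' * tan (phase)`. -/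
structure IsDiagonalGeodesic {ι : Type*} [Fintype ι] (θ₀ : ℝ) (α r : ι → ℝ → ℝ)
    (κ : ι → ℝ) : Prop where
  smooth_angle : ∀ j, ContDiffOn ℝ ∞ (α j) (Icc 0 1)
  smooth_radius : ∀ j, ContDiffOn ℝ ∞ (r j) (Icc 0 1)
  angle_zero : ∀ j, α j 0 = 0
  radius_pos : ∀ j, ∀ t ∈ Icc (0 : ℝ) 1, 0 < r j t
  phase_mem : ∀ t ∈ Icc (0 : ℝ) 1, θ₀ + ∑ j, α j t ∈ Ioo (-(Real.pi / 2)) (Real.pi / 2)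
  angle_deriv : ∀ j, ∀ t ∈ Icc (0 : ℝ) 1,
    HasDerivWithinAt (α j) (κ j / r j t ^ 2) (Icc 0 1) t
  radius_deriv : ∀ j, ∀ t ∈ Icc (0 : ℝ) 1,
    HasDerivWithinAt (r j) (r j t * (κ j / r j t ^ 2) * Real.tan (θ₀ + ∑ j, α j t)) (Icc 0 1) t

/-- The solution is parameterized by `x`, the tangent of the phase, running from `a` to `b`; the
common value of the `κ j` is the total time `T` before rescaling to `[0, 1]`. -/
theorem exists_diagonalGeodesic_of_pos {θ₀ : ℝ} {β : ι → ℝ} (hpos : ∀ j, 0 < β j)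
    (h0 : θ₀ ∈ Ioo (-(Real.pi / 2)) (Real.pi / 2))
    (h1 : θ₀ + ∑ j, β j ∈ Ioo (-(Real.pi / 2)) (Real.pi / 2)) :
    ∃ (α r : ι → ℝ → ℝ) (κ : ι → ℝ), IsDiagonalGeodesic θ₀ α r κ ∧ (∀ j, α j 1 = β j) ∧
      ∀ j, 0 < κ j := by
  set a := Real.tan θ₀ with ha
  set b := Real.tan (θ₀ + ∑ j, β j) with hb
  have hsum : 0 < ∑ j, β j := Finset.sum_pos (fun j _ => hpos j) Finset.univ_nonempty
  have hata : Real.arctan a = θ₀ := Real.arctan_tan h0.1 h0.2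
  have hatb : Real.arctan b = θ₀ + ∑ j, β j := Real.arctan_tan h1.1 h1.2
  have hab : a < b := by
    rw [← Real.arctan_strictMono.lt_iff_lt, hata, hatb]
    linarith
  obtain ⟨c, hc⟩ := exists_integral_rootWeight_eq (β := β) hab.le hpos (by rw [hata, hatb]; ring)
  have hw : ContDiff ℝ ∞ fun x : ℝ => 1 + x ^ 2 := by fun_prop
  have hw0 : ∀ x : ℝ, 1 + x ^ 2 ≠ 0 := fun x => by positivity
  -- With this density `ξ' = T (1 + ξ²) recipSum c ξ`, which makes `(α j)' = T / (r j)²`.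
  obtain ⟨T, ξ, hT, hξ0, hξ1, hξ, hξ'⟩ := exists_smooth_time_change
    (D := fun x => ((1 + x ^ 2) * recipSum c x)⁻¹)
    ((hw.mul (contDiff_recipSum c)).inv fun x => mul_ne_zero (hw0 x) (recipSum_pos c x).ne')
    (fun x => inv_pos.2 (mul_pos (by positivity) (recipSum_pos c x))) hab
  have hweight : ∀ j, ContDiff ℝ ∞ fun x => rootWeight c j x / (1 + x ^ 2) := fun j =>
    (contDiff_rootWeight c j).div hw hw0
  set α : ι → ℝ → ℝ := fun j t => ∫ x in a..ξ t, rootWeight c j x / (1 + x ^ 2) with hα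
  set r : ι → ℝ → ℝ := fun j t => √(prodRoot c (ξ t) + c j) with hr
  have hphase : ∀ t, θ₀ + ∑ j, α j t = Real.arctan (ξ t) := fun t => by
    rw [hα]
    simp only [sum_integral_rootWeight, hata]
    ring
  have hsq : ∀ j t, r j t ^ 2 = prodRoot c (ξ t) + c j := fun j t =>
    Real.sq_sqrt (prodRoot_pos c _ j).le
  have hrpos : ∀ j t, 0 < r j t := fun j t => Real.sqrt_pos.2 (prodRoot_pos c _ j)
  refine ⟨α, r, fun _ => T, ⟨fun j => ?_, fun j => ?_, fun j => ?_, fun j t _ => hrpos j t,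
    fun t _ => ?_, fun j t ht => ?_, fun j t ht => ?_⟩, fun j => ?_, fun _ => hT⟩
  · exact (contDiff_integral (hweight j) a).comp_contDiffOn hξ
  · exact (((contDiff_prodRoot c).comp_contDiffOn hξ).add contDiffOn_const).sqrt
      fun t _ => (prodRoot_pos c _ j).ne'
  · simp [hα, hξ0]
  · rw [hphase]
    exact ⟨Real.neg_pi_div_two_lt_arctan _, Real.arctan_lt_pi_div_two _⟩
  · refine ((hasDerivAt_integral_of_contDiff (hweight j) a (ξ t)).comp_hasDerivWithinAt t
      (hξ' t ht)).congr_deriv ?_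
    rw [hsq, rootWeight]
    have := (recipSum_pos c (ξ t)).ne'
    have := (prodRoot_pos c (ξ t) j).ne'
    have := hw0 (ξ t)
    field_simp
  · have hd := (((hasDerivAt_prodRoot c (ξ t)).comp_hasDerivWithinAt t
      (hξ' t ht)).add_const (c j)).sqrt (prodRoot_pos c _ j).ne'
    refine hd.congr_deriv ?_
    rw [hphase, Real.tan_arctan]
    change _ / (2 * r j t) = _
    have := (recipSum_pos c (ξ t)).ne'
    have := (hrpos j t).ne'
    have := hw0 (ξ t)
    field_simp
  · simp only [hα, hξ1, hc]

end Smooth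

/-- Directions with zero angle are frozen (`α = 0`, `r = 1`, `κ = 0`) and do not affect the phase;
the others, if any, form a positive problem. -/
theorem exists_diagonalGeodesic {ι : Type*} [Fintype ι] {θ₀ : ℝ} {β : ι → ℝ}
    (hnonneg : ∀ j, 0 ≤ β j) (h0 : θ₀ ∈ Ioo (-(Real.pi / 2)) (Real.pi / 2))
    (h1 : θ₀ + ∑ j, β j ∈ Ioo (-(Real.pi / 2)) (Real.pi / 2)) :
    ∃ (α r : ι → ℝ → ℝ) (κ : ι → ℝ), IsDiagonalGeodesic θ₀ α r κ ∧ (∀ j, α j 1 = β j) ∧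
      (∀ j, 0 ≤ κ j) ∧ ∀ j, 0 < β j → 0 < κ j := by
  classical
  by_cases hne : Nonempty {j // 0 < β j}
  · have hsum : ∀ f : ι → ℝ, (∀ j, ¬ 0 < β j → f j = 0) →
        ∑ j, f j = ∑ j : {j // 0 < β j}, f j := fun f hf => by
      rw [← Fintype.sum_subtype_add_sum_subtype (fun j => 0 < β j) f,
        Finset.sum_eq_zero (s := (Finset.univ : Finset {j // ¬ 0 < β j}))
          fun j _ => hf j j.2, add_zero]
    have hβ0 : ∀ j, ¬ 0 < β j → β j = 0 := fun j hj => le_antisymm (not_lt.1 hj) (hnonneg j)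
    rw [hsum β hβ0] at h1
    obtain ⟨α, r, κ, hg, hα1, hκ⟩ := exists_diagonalGeodesic_of_pos
      (β := fun j : {j // 0 < β j} => β j) (fun j => j.2) h0 h1
    set α' : ι → ℝ → ℝ := fun j => if h : 0 < β j then α ⟨j, h⟩ else fun _ => 0 with hα'
    set r' : ι → ℝ → ℝ := fun j => if h : 0 < β j then r ⟨j, h⟩ else fun _ => 1 with hr'
    set κ' : ι → ℝ := fun j => if h : 0 < β j then κ ⟨j, h⟩ else 0 with hκ'
    have hsum' : ∀ t, ∑ j, α' j t = ∑ j, α j t := fun t => by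
      rw [hsum _ fun j hj => by simp [hα', hj]]
      exact Finset.sum_congr rfl fun j _ => by simp [hα', j.2]
    refine ⟨α', r', κ', ⟨fun j => ?_, fun j => ?_, fun j => ?_, fun j => ?_, fun t ht => ?_,
      fun j => ?_, fun j => ?_⟩, fun j => ?_, fun j => ?_, fun j hj => ?_⟩
    · by_cases h : 0 < β j
      · simpa [hα', h] using hg.smooth_angle ⟨j, h⟩
      · simpa [hα', h] using contDiffOn_const
    · by_cases h : 0 < β j
      · simpa [hr', h] using hg.smooth_radius ⟨j, h⟩
      · simpa [hr', h] using contDiffOn_const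
    · by_cases h : 0 < β j
      · simpa [hα', h] using hg.angle_zero ⟨j, h⟩
      · simp [hα', h]
    · by_cases h : 0 < β j
      · simpa [hr', h] using hg.radius_pos ⟨j, h⟩
      · simp [hr', h]
    · rw [hsum']
      exact hg.phase_mem t ht
    · by_cases h : 0 < β j
      · simpa [hα', hr', hκ', h] using hg.angle_deriv ⟨j, h⟩
      · intro t _
        simpa [hα', hr', hκ', h] using hasDerivWithinAt_const t (Icc (0 : ℝ) 1) (0 : ℝ)
    · simp only [hsum']
      by_cases h : 0 < β j
      · simpa [hr', hκ', h] using hg.radius_deriv ⟨j, h⟩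
      · intro t _
        simpa [hr', hκ', h] using hasDerivWithinAt_const t (Icc (0 : ℝ) 1) (1 : ℝ)
    · by_cases h : 0 < β j
      · simpa [hα', h] using hα1 ⟨j, h⟩
      · simp [hα', hβ0 j h]
    · by_cases h : 0 < β j
      · simpa [hκ', h] using (hκ ⟨j, h⟩).le
      · simp [hκ', h]
    · simpa [hκ', hj] using hκ ⟨j, hj⟩
  · have hβ0 : ∀ j, β j = 0 := fun j =>
      le_antisymm (not_lt.1 fun h => hne ⟨⟨j, h⟩⟩) (hnonneg j)
    refine ⟨fun _ _ => 0, fun _ _ => 1, fun _ => 0, ⟨fun j => contDiffOn_const,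
      fun j => contDiffOn_const, fun j => rfl, fun j t _ => one_pos, fun t _ => by simpa using h0,
      fun j t _ => ?_, fun j t _ => ?_⟩, fun j => (hβ0 j).symm, fun j => le_rfl, fun j hj => ?_⟩
    · simpa using hasDerivWithinAt_const t (Icc (0 : ℝ) 1) (0 : ℝ)
    · simpa using hasDerivWithinAt_const t (Icc (0 : ℝ) 1) (1 : ℝ)
    · exact absurd (hβ0 j) hj.ne'

/-! ### Pairs of Lagrangian subspaces -/

section LinearAlgebra

variable {n : ℕ}

theorem real_inner_eq_re_inner (u v : CSpace n) : inner ℝ u v = (inner ℂ u v).re := by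
  simp [PiLp.inner_apply, Complex.inner]

theorem inner_eq_ofReal {L : Submodule ℝ (CSpace n)} (hL : IsLagrangian L) {u v : CSpace n}
    (hu : u ∈ L) (hv : v ∈ L) : inner ℂ u v = ((inner ℂ u v).re : ℂ) :=
  Complex.ext rfl ((hL.2 u hu v hv).trans (Complex.ofReal_im _).symm)

theorem exists_orthonormalBasis_of_orthonormal {u : Fin n → CSpace n} (hu : Orthonormal ℂ u) :
    ∃ b : OrthonormalBasis (Fin n) ℂ (CSpace n), ⇑b = u :=
  ⟨OrthonormalBasis.mk hu (hu.linearIndependent.span_eq_top_of_card_eq_finrank' (by simp)).ge,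
    by simp⟩

/-- On a Lagrangian subspace the Hermitian product is real, so a real orthonormal basis is unitary.
-/
theorem exists_unitary_frame {L : Submodule ℝ (CSpace n)} (hL : IsLagrangian L) :
    ∃ u : OrthonormalBasis (Fin n) ℂ (CSpace n), ∀ i, u i ∈ L := by
  let b := (stdOrthonormalBasis ℝ L).reindex (finCongr hL.1)
  have hb : Orthonormal ℂ fun i => (b i : CSpace n) := by
    rw [orthonormal_iff_ite]
    intro i j
    have h := (orthonormal_iff_ite.1 b.orthonormal) i j
    rw [Submodule.coe_inner, real_inner_eq_re_inner] at h
    rw [inner_eq_ofReal hL (b i).2 (b j).2, h]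
    split_ifs <;> simp
  obtain ⟨u, hu⟩ := exists_orthonormalBasis_of_orthonormal hb
  exact ⟨u, fun i => hu ▸ (b i).2⟩

/-- Otherwise each `γ` gives a nonzero `x γ ∈ L` in `i e^{iγ} span_ℝ u`. The product of `x γ` and `x
γ'` is `e^{i(γ' - γ)}` times a real number, yet real since `L` is Lagrangian, so it vanishes for
distinct angles in `[0, π)`: too many orthogonal vectors. -/
theorem exists_transverse_angle (u : OrthonormalBasis (Fin n) ℂ (CSpace n))
    {L : Submodule ℝ (CSpace n)} (hL : IsLagrangian L) :
    ∃ γ : ℝ, ∀ x ∈ L, (∀ i, (Complex.exp (-(γ * Complex.I)) * inner ℂ (u i) x).re = 0) →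
      x = 0 := by
  by_contra! hcon
  choose x hxL hx hx0 using hcon
  have hcoord : ∀ γ i, ∃ a : ℝ, inner ℂ (u i) (x γ) =
      Complex.exp (γ * Complex.I) * (Complex.I * a) := fun γ i => by
    refine ⟨(Complex.exp (-(γ * Complex.I)) * inner ℂ (u i) (x γ)).im, ?_⟩
    have h1 : Complex.I * ((Complex.exp (-(γ * Complex.I)) * inner ℂ (u i) (x γ)).im : ℂ) =
        Complex.exp (-(γ * Complex.I)) * inner ℂ (u i) (x γ) :=
      Complex.ext (by simpa using (hx γ i).symm) (by simp)
    rw [h1, ← mul_assoc, ← Complex.exp_add]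
    simp
  choose a ha using hcoord
  have horth : ∀ γ ∈ Ico 0 Real.pi, ∀ γ' ∈ Ico 0 Real.pi, γ ≠ γ' →
      inner ℂ (x γ) (x γ') = 0 := by
    intro γ hγ γ' hγ' hne
    have h1 : ∃ a : ℝ, inner ℂ (x γ) (x γ') =
        Complex.exp (((γ' - γ : ℝ) : ℂ) * Complex.I) * a := by
      refine ⟨∑ i, a γ i * a γ' i, ?_⟩
      rw [← u.sum_inner_mul_inner, Complex.ofReal_sum, Finset.mul_sum]
      refine Finset.sum_congr rfl fun i _ => ?_
      rw [← inner_conj_symm (x γ) (u i), ha γ i, ha γ' i]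
      have h2 : Complex.exp (((γ' - γ : ℝ) : ℂ) * Complex.I) =
          Complex.exp (γ' * Complex.I) * Complex.exp (-(γ * Complex.I)) := by
        rw [← Complex.exp_add]
        push_cast
        ring_nf
      rw [h2]
      simp only [map_mul, ← Complex.exp_conj, Complex.conj_I, Complex.conj_ofReal, mul_neg]
      push_cast
      linear_combination (-Complex.exp (↑γ' * Complex.I) * Complex.exp (-(↑γ * Complex.I)) *
        (a γ i : ℂ) * a γ' i) * Complex.I_sq
    obtain ⟨d, hd⟩ := h1
    have h2 := hL.2 _ (hxL γ) _ (hxL γ')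
    rw [symp, hd, Complex.im_mul_ofReal, Complex.exp_ofReal_mul_I_im] at h2
    have h3 : Real.sin (γ' - γ) ≠ 0 := by
      intro h
      rw [Real.sin_eq_zero_iff_of_lt_of_lt (by linarith [hγ.2, hγ'.1])
        (by linarith [hγ.1, hγ'.2])] at h
      exact hne (by linarith)
    rw [hd, (mul_eq_zero.1 h2).resolve_left h3]
    simp
  have hli : LinearIndependent ℂ fun γ : Ico 0 Real.pi => x γ :=
    linearIndependent_of_ne_zero_of_inner_eq_zero (fun γ => hx0 γ)
      fun γ γ' hne => horth γ γ.2 γ' γ'.2 fun h => hne (Subtype.ext h)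
  have : Finite (Ico (0 : ℝ) Real.pi) := hli.finite
  exact (Ico_infinite Real.pi_pos) (toFinite _)

theorem exists_angle_of_ne_zero {z : ℂ} (hz : z ≠ 0) :
    ∃ β ∈ Ico 0 Real.pi, ∃ c : ℝ, Complex.exp (β * Complex.I) = c * z := by
  have hn : (‖z‖ : ℂ) ≠ 0 := by simpa using hz
  have h := Complex.norm_mul_exp_arg_mul_I z
  have h' : Complex.exp (z.arg * Complex.I) = (‖z‖ : ℂ)⁻¹ * z := by
    nth_rewrite 3 [← h]
    field_simp
  have hle := Complex.arg_le_pi z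
  have hlt := Complex.neg_pi_lt_arg z
  rcases lt_or_ge z.arg 0 with h0 | h0
  · refine ⟨z.arg + Real.pi, ⟨by linarith, by linarith⟩, -‖z‖⁻¹, ?_⟩
    push_cast
    rw [add_mul, Complex.exp_add, h', Complex.exp_pi_mul_I]
    ring
  · rcases hle.lt_or_eq with h1 | h1
    · exact ⟨z.arg, ⟨h0, h1⟩, ‖z‖⁻¹, by push_cast; exact h'⟩
    · refine ⟨0, ⟨le_rfl, Real.pi_pos⟩, -‖z‖⁻¹, ?_⟩
      rw [h1, Complex.exp_pi_mul_I] at h'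
      push_cast
      rw [zero_mul, Complex.exp_zero]
      linear_combination -h'

/-- A unitary basis diagonalizing a pair of Lagrangian subspaces. -/
theorem exists_common_frame {L₀ L₁ : Submodule ℝ (CSpace n)} (h₀ : IsLagrangian L₀)
    (h₁ : IsLagrangian L₁) :
    ∃ (u : OrthonormalBasis (Fin n) ℂ (CSpace n)) (β : Fin n → ℝ),
      (∀ j, u j ∈ L₀) ∧ (∀ j, β j ∈ Ico 0 Real.pi) ∧
      ∀ j, Complex.exp (β j * Complex.I) • u j ∈ L₁ := by
  obtain ⟨u, hu⟩ := exists_unitary_frame h₀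
  obtain ⟨γ, hγ⟩ := exists_transverse_angle u h₁
  set e : ℂ := Complex.exp (-(γ * Complex.I)) with he
  have hee : Complex.exp (γ * Complex.I) * e = 1 := by
    rw [he, ← Complex.exp_add]
    simp
  -- After rotation by `-γ`, `L₁` is a graph over the real span of `u`: the imaginary coordinates
  -- are a linear function `B` of the real ones.
  let reMap : L₁ →ₗ[ℝ] RSpace n :=
    { toFun := fun x => WithLp.toLp 2 fun i => (e * inner ℂ (u i) (x : CSpace n)).re
      map_add' := fun x y => by
        ext i
        simp [mul_add]
      map_smul' := fun c x => by
        ext i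
        simp only [Submodule.coe_smul, ← Complex.coe_smul, inner_smul_right, PiLp.smul_apply,
          RingHom.id_apply, smul_eq_mul, mul_left_comm e, Complex.re_ofReal_mul] }
  let imMap : L₁ →ₗ[ℝ] RSpace n :=
    { toFun := fun x => WithLp.toLp 2 fun i => (e * inner ℂ (u i) (x : CSpace n)).im
      map_add' := fun x y => by
        ext i
        simp [mul_add]
      map_smul' := fun c x => by
        ext i
        simp only [Submodule.coe_smul, ← Complex.coe_smul, inner_smul_right, PiLp.smul_apply,
          RingHom.id_apply, smul_eq_mul, mul_left_comm e, Complex.im_ofReal_mul] }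
  have hre : ∀ x i, reMap x i = (e * inner ℂ (u i) (x : CSpace n)).re := fun x i => rfl
  have him : ∀ x i, imMap x i = (e * inner ℂ (u i) (x : CSpace n)).im := fun x i => rfl
  have hinj : Function.Injective reMap := by
    rw [injective_iff_map_eq_zero]
    intro x hx
    refine Subtype.ext (hγ x x.2 fun i => ?_)
    rw [← hre, hx]
    rfl
  let M : L₁ ≃ₗ[ℝ] RSpace n := reMap.linearEquivOfInjective hinj (by simp [h₁.1])
  have hM : ∀ x, reMap (M.symm x) = x := fun x => M.apply_symm_apply x
  let B : RSpace n →ₗ[ℝ] RSpace n := imMap ∘ₗ M.symm.toLinearMap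
  -- Isotropy of `L₁` is symmetry of `B`, whose real eigenvectors give the common frame.
  have hcross : ∀ x y : L₁, inner ℝ (imMap x) (reMap y) = inner ℝ (reMap x) (imMap y) := by
    intro x y
    have h1 := h₁.2 x x.2 y y.2
    have h2 : inner ℂ (x : CSpace n) (y : CSpace n) =
        ∑ i, (starRingEnd ℂ) (e * inner ℂ (u i) (x : CSpace n)) *
          (e * inner ℂ (u i) (y : CSpace n)) := by
      rw [← u.sum_inner_mul_inner]
      refine Finset.sum_congr rfl fun i _ => ?_
      rw [← inner_conj_symm (x : CSpace n) (u i), map_mul, he, ← Complex.exp_conj]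
      have h3 : Complex.exp ((starRingEnd ℂ) (-(γ * Complex.I))) =
          Complex.exp (γ * Complex.I) := by simp
      rw [h3]
      linear_combination (-(starRingEnd ℂ) (inner ℂ (u i) (x : CSpace n)) *
        inner ℂ (u i) (y : CSpace n)) * hee
    rw [symp, h2, Complex.im_sum] at h1
    rw [← sub_eq_zero, PiLp.inner_apply, PiLp.inner_apply, ← Finset.sum_sub_distrib,
      ← neg_eq_zero, ← Finset.sum_neg_distrib, ← h1]
    refine Finset.sum_congr rfl fun i _ => ?_
    rw [hre, hre, him, him, Complex.mul_im ((starRingEnd ℂ) _)]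
    simp only [RCLike.inner_apply, conj_trivial, Complex.conj_re, Complex.conj_im]
    ring
  have hB : B.IsSymmetric := fun x y => by
    have := hcross (M.symm x) (M.symm y)
    rwa [hM, hM] at this
  let f := hB.eigenvectorBasis finrank_euclideanSpace_fin
  let b := hB.eigenvalues finrank_euclideanSpace_fin
  have hBf : ∀ j, B (f j) = b j • f j := hB.apply_eigenvectorBasis finrank_euclideanSpace_fin
  let v : Fin n → CSpace n := fun j => ∑ i, ((f j i : ℝ) : ℂ) • u i
  have hv : Orthonormal ℂ v := by
    rw [orthonormal_iff_ite]
    intro j k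
    have h1 := (orthonormal_iff_ite.1 f.orthonormal) j k
    rw [u.orthonormal.inner_sum]
    rw [PiLp.inner_apply] at h1
    simp only [RCLike.inner_apply, conj_trivial] at h1
    simp only [Complex.conj_ofReal, ← Complex.ofReal_mul, ← Complex.ofReal_sum]
    simp only [mul_comm (f j _), h1]
    split_ifs <;> simp
  have hxv : ∀ j, ((M.symm (f j) : L₁) : CSpace n) =
      (Complex.exp (γ * Complex.I) * (1 + b j * Complex.I)) • v j := by
    intro j
    rw [← u.sum_repr' (M.symm (f j) : CSpace n), Finset.smul_sum]
    refine Finset.sum_congr rfl fun i _ => ?_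
    rw [smul_smul]
    congr 1
    have h1 : e * inner ℂ (u i) (M.symm (f j) : CSpace n) =
        (f j i : ℂ) + (b j * f j i : ℝ) * Complex.I := by
      have h2 := congrArg (fun w : RSpace n => w i) (hM (f j))
      have h3 := congrArg (fun w : RSpace n => w i) (hBf j)
      have h3' : imMap (M.symm (f j)) i = b j * f j i := h3
      refine Complex.ext ?_ ?_
      · rw [← hre]
        simpa using h2
      · rw [← him]
        simpa using h3'
    push_cast at h1
    linear_combination Complex.exp (γ * Complex.I) * h1 -
      inner ℂ (u i) (M.symm (f j) : CSpace n) * hee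
  have hne : ∀ j, Complex.exp (γ * Complex.I) * (1 + b j * Complex.I) ≠ 0 := fun j => by
    refine mul_ne_zero (Complex.exp_ne_zero _) fun h => ?_
    simpa using congrArg Complex.re h
  choose β hβ c hc using fun j => exists_angle_of_ne_zero (hne j)
  obtain ⟨w, hw⟩ := exists_orthonormalBasis_of_orthonormal hv
  refine ⟨w, β, fun j => ?_, hβ, fun j => ?_⟩
  · rw [hw]
    refine Submodule.sum_mem _ fun i _ => ?_
    rw [Complex.coe_smul]
    exact L₀.smul_mem _ (hu i)
  · rw [hw, hc, mul_smul, ← hxv, Complex.coe_smul]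
    exact L₁.smul_mem _ (M.symm (f j)).2

/-- If `β j ≠ b`, the product of `e^{iβⱼ} uⱼ` with `e^{ib} x` is real, but also `e^{i(b - βⱼ)}`
times the real coefficient of `x` along `uⱼ`; as `0 < |b - βⱼ| < π`, the coefficient is zero. -/
theorem argSpace_eq_span {L₀ L₁ : LGPos n} {u : OrthonormalBasis (Fin n) ℂ (CSpace n)}
    {β : Fin n → ℝ} (hu : ∀ j, u j ∈ L₀.space) (hβ : ∀ j, β j ∈ Ico 0 Real.pi)
    (hu₁ : ∀ j, Complex.exp (β j * Complex.I) • u j ∈ L₁.space) {b : ℝ}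
    (hb : b ∈ Ico 0 Real.pi) :
    argSpace L₀ L₁ b = Submodule.span ℝ (range fun j : {j // β j = b} => u j) := by
  refine le_antisymm ?_ ?_
  · rintro x ⟨hx₀, hx₁⟩
    rw [← u.sum_repr' x]
    refine Submodule.sum_mem _ fun j _ => ?_
    have hreal := inner_eq_ofReal L₀.2.1 (hu j) hx₀
    by_cases hj : β j = b
    · rw [hreal, Complex.coe_smul]
      exact Submodule.smul_mem _ _ (Submodule.subset_span ⟨⟨j, hj⟩, rfl⟩)
    · have h1 := L₁.2.1.2 _ (hu₁ j) _ hx₁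
      have h2 : inner ℂ (Complex.exp (β j * Complex.I) • u j) (Complex.exp (b * Complex.I) • x) =
          Complex.exp (((b - β j : ℝ) : ℂ) * Complex.I) * ((inner ℂ (u j) x).re : ℂ) := by
        rw [inner_smul_left, inner_smul_right, ← hreal, ← Complex.exp_conj, ← mul_assoc,
          ← Complex.exp_add]
        congr 2
        simp
        ring
      rw [symp, h2, Complex.im_mul_ofReal, Complex.exp_ofReal_mul_I_im] at h1
      have h3 : Real.sin (b - β j) ≠ 0 := by
        intro h
        rw [Real.sin_eq_zero_iff_of_lt_of_lt (by linarith [(hβ j).2, hb.1])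
          (by linarith [(hβ j).1, hb.2])] at h
        exact hj (by linarith)
      rw [hreal, (mul_eq_zero.1 h1).resolve_left h3]
      simp
  · rw [Submodule.span_le]
    rintro _ ⟨⟨j, rfl⟩, rfl⟩
    exact ⟨hu j, hu₁ j⟩

theorem finsum_argSpace {L₀ L₁ : LGPos n} {u : OrthonormalBasis (Fin n) ℂ (CSpace n)}
    {β : Fin n → ℝ} (hu : ∀ j, u j ∈ L₀.space) (hβ : ∀ j, β j ∈ Ico 0 Real.pi)
    (hu₁ : ∀ j, Complex.exp (β j * Complex.I) • u j ∈ L₁.space) :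
    ∑ᶠ (b : ℝ) (_ : b ∈ Ico 0 Real.pi), (Module.finrank ℝ (argSpace L₀ L₁ b) : ℝ) * b =
      ∑ j, β j := by
  classical
  have hli : LinearIndependent ℝ u :=
    u.orthonormal.linearIndependent.restrict_scalars' ℝ
  have hcard : ∀ b ∈ Ico 0 Real.pi, Module.finrank ℝ (argSpace L₀ L₁ b) =
      (Finset.univ.filter fun j => β j = b).card := fun b hb => by
    rw [argSpace_eq_span hu hβ hu₁ hb, ← Fintype.card_subtype]
    exact finrank_span_eq_card (hli.comp (Subtype.val : {j // β j = b} → Fin n)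
        Subtype.val_injective)
  rw [finsum_mem_congr rfl fun b hb => by rw [hcard b hb]]
  rw [finsum_mem_eq_sum_of_inter_support_eq (t := Finset.univ.image β)]
  · rw [Finset.sum_comp (fun b : ℝ => b) β]
    simp
  · ext b
    simp only [mem_inter_iff, Function.mem_support, Finset.coe_image, Finset.coe_univ,
      image_univ, mem_range]
    refine and_congr_left fun h => ⟨fun _ => ?_, ?_⟩
    · by_contra! hcon
      simp [hcon] at h
    · rintro ⟨j, rfl⟩
      exact hβ j

end LinearAlgebra

/-! ### Geodesics of diagonal form -/

section Geodesic

variable {n : ℕ}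

theorem holVol_update_smul (v : Fin n → CSpace n) (i : Fin n) (c : ℂ) (w : CSpace n) :
    holVol (Function.update v i (c • w)) = c * holVol (Function.update v i w) := by
  have h : ∀ w : CSpace n, (Matrix.of fun k j => (Function.update v i w) k j) =
      (Matrix.of fun k j => v k j).updateRow i (WithLp.ofLp w) := fun w => by
    ext k j
    by_cases hk : k = i
    · subst hk
      simp
    · simp [hk]
  unfold holVol
  rw [h, h]
  exact Matrix.det_updateRow_smul _ _ _ _

theorem holVol_smul (z : Fin n → ℂ) (v : Fin n → CSpace n) :
    holVol (fun j => z j • v j) = (∏ j, z j) * holVol v :=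
  Matrix.det_mul_column z (Matrix.of fun i j => v i j)

theorem isPositive_of_re_ne_zero {L : Submodule ℝ (CSpace n)} {v : Fin n → CSpace n}
    (hv : ∀ i, v i ∈ L) (h : (holVol v).re ≠ 0) : IsPositive L := by
  rcases h.lt_or_gt with h | h
  · rcases n with - | n
    -- In dimension zero there is no vector to negate, but the empty determinant is `1`.
    · simp [holVol] at h
      linarith
    · refine ⟨Function.update v 0 ((-1 : ℂ) • v 0), fun i => ?_, ?_⟩
      · by_cases hi : i = 0
        · subst hi
          simpa using hv 0
        · simpa [hi] using hv i
      · rw [holVol_update_smul, Function.update_eq_self]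
        simpa using h
  · exact ⟨v, hv, h⟩

theorem phase_mem_Ioo (L : LGPos n) : phase L ∈ Ioo (-(Real.pi / 2)) (Real.pi / 2) :=
  abs_lt.1 (Complex.abs_arg_lt_pi_div_two_iff.2 (Or.inl (Classical.choose_spec L.2.2).2))

/-- The sign of `d` is left open because `u` carries no chosen orientation. -/
theorem holVol_unitary_frame (L : LGPos n) {u : OrthonormalBasis (Fin n) ℂ (CSpace n)}
    (hu : ∀ j, u j ∈ L.space) :
    ∃ d : ℝ, d ≠ 0 ∧ holVol u = d * Complex.exp (phase L * Complex.I) := by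
  have hli : LinearIndependent ℝ fun j => (⟨u j, hu j⟩ : L.space) :=
    LinearIndependent.of_comp L.space.subtype
      (u.orthonormal.linearIndependent.restrict_scalars' ℝ)
  let b := basisOfLinearIndependentOfCardEqFinrank' _ hli (by simp [L.2.1.1])
  have hv := Classical.choose_spec L.2.2
  obtain ⟨c, hc⟩ := holVol_frame L b _ hv.1
  have hb : (fun i => (b i : CSpace n)) = u := by
    ext i
    simp [b]
  rw [hb] at hc
  have hc0 : c ≠ 0 := by
    rintro rfl
    have h := hv.2
    rw [hc] at h
    simp at h
  have hv0 : holVol (Classical.choose L.2.2) ≠ 0 := fun h0 => by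
    have h := hv.2
    rw [h0] at h
    simp at h
  refine ⟨c⁻¹ * ‖holVol (Classical.choose L.2.2)‖, mul_ne_zero (inv_ne_zero hc0) (by simpa), ?_⟩
  have h1 := Complex.norm_mul_exp_arg_mul_I (holVol (Classical.choose L.2.2))
  push_cast
  rw [mul_assoc, phase, h1, hc]
  have : (c : ℂ) ≠ 0 := by exact_mod_cast hc0
  field_simp

/-- The real linear map `x ↦ ∑ xⱼ zⱼ uⱼ`. -/
def diagMap (u : OrthonormalBasis (Fin n) ℂ (CSpace n)) (z : Fin n → ℂ) :
    RSpace n →ₗ[ℝ] CSpace n where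
  toFun x := ∑ j, ((x j : ℂ) * z j) • u j
  map_add' x y := by
    simp [add_mul, add_smul, Finset.sum_add_distrib]
  map_smul' c x := by
    simp [mul_assoc, mul_smul, Finset.smul_sum]

theorem diagMap_apply (u : OrthonormalBasis (Fin n) ℂ (CSpace n)) (z : Fin n → ℂ)
    (x : RSpace n) : diagMap u z x = ∑ j, ((x j : ℂ) * z j) • u j := rfl

theorem inner_diagMap (u : OrthonormalBasis (Fin n) ℂ (CSpace n)) (z w : Fin n → ℂ)
    (x y : RSpace n) : inner ℂ (diagMap u z x) (diagMap u w y) =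
      ∑ j, ((x j * y j : ℝ) : ℂ) * ((starRingEnd ℂ) (z j) * w j) := by
  rw [diagMap_apply, diagMap_apply, u.orthonormal.inner_sum]
  refine Finset.sum_congr rfl fun j _ => ?_
  simp only [map_mul, Complex.conj_ofReal]
  push_cast
  ring

theorem diagMap_single (u : OrthonormalBasis (Fin n) ℂ (CSpace n)) (z : Fin n → ℂ) (i : Fin n) :
    diagMap u z (EuclideanSpace.single i 1) = z i • u i := by
  rw [diagMap_apply, Finset.sum_eq_single i]
  · simp
  · intro j _ hj
    simp [hj]
  · simp

theorem diagMap_injective (u : OrthonormalBasis (Fin n) ℂ (CSpace n)) {z : Fin n → ℂ}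
    (hz : ∀ j, z j ≠ 0) : Function.Injective (diagMap u z) := by
  rw [injective_iff_map_eq_zero]
  intro x hx
  ext j
  have h := (Fintype.linearIndependent_iff.1 u.orthonormal.linearIndependent) _ hx j
  simpa [hz j] using h

theorem finrank_range_diagMap (u : OrthonormalBasis (Fin n) ℂ (CSpace n)) {z : Fin n → ℂ}
    (hz : ∀ j, z j ≠ 0) : Module.finrank ℝ (LinearMap.range (diagMap u z)) = n := by
  rw [LinearMap.finrank_range_of_inj (diagMap_injective u hz), finrank_euclideanSpace_fin]

theorem isLagrangian_range_diagMap (u : OrthonormalBasis (Fin n) ℂ (CSpace n)) {z : Fin n → ℂ}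
    (hz : ∀ j, z j ≠ 0) : IsLagrangian (LinearMap.range (diagMap u z)) := by
  refine ⟨finrank_range_diagMap u hz, ?_⟩
  rintro _ ⟨x, rfl⟩ _ ⟨y, rfl⟩
  rw [symp, inner_diagMap, Complex.im_sum]
  refine Finset.sum_eq_zero fun j _ => ?_
  rw [Complex.im_ofReal_mul, ← Complex.normSq_eq_conj_mul_self, Complex.ofReal_im, mul_zero]

theorem isPositive_range_diagMap (u : OrthonormalBasis (Fin n) ℂ (CSpace n)) {z : Fin n → ℂ}
    (h : ((∏ j, z j) * holVol u).re ≠ 0) : IsPositive (LinearMap.range (diagMap u z)) := by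
  refine isPositive_of_re_ne_zero (v := fun j => z j • u j)
    (fun i => ⟨_, diagMap_single u z i⟩) ?_
  rwa [holVol_smul]

theorem range_diagMap_eq (u : OrthonormalBasis (Fin n) ℂ (CSpace n)) {z : Fin n → ℂ}
    (hz : ∀ j, z j ≠ 0) {L : Submodule ℝ (CSpace n)} (hL : IsLagrangian L)
    (h : ∀ j, z j • u j ∈ L) : LinearMap.range (diagMap u z) = L := by
  refine Submodule.eq_of_le_of_finrank_eq ?_ ((finrank_range_diagMap u hz).trans hL.1.symm)
  rintro _ ⟨x, rfl⟩
  rw [diagMap_apply]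
  refine Submodule.sum_mem _ fun j _ => ?_
  rw [mul_smul, Complex.coe_smul]
  exact L.smul_mem _ (h j)

/-- The velocity of the lifting has this form with `a = tan θ + i`, so it is one complex multiple of
a vector of the subspace. -/
theorem diagMap_mul_ofReal (u : OrthonormalBasis (Fin n) ℂ (CSpace n)) (z : Fin n → ℂ) (a : ℂ)
    (c : Fin n → ℝ) (x : RSpace n) : diagMap u (fun j => a * c j * z j) x =
      a • diagMap u z (WithLp.toLp 2 fun j => c j * x j) := by
  simp only [diagMap_apply, Finset.smul_sum, smul_smul]
  refine Finset.sum_congr rfl fun j _ => ?_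
  congr 1
  push_cast
  ring

theorem holVol_diagMap (u : OrthonormalBasis (Fin n) ℂ (CSpace n)) (z : Fin n → ℂ)
    (ξ : Fin n → RSpace n) :
    ∃ c : ℝ, holVol (fun j => diagMap u z (ξ j)) = c * ((∏ j, z j) * holVol u) := by
  refine ⟨(Matrix.of fun i j => ξ i j).det, ?_⟩
  rw [← holVol_smul, holVol, holVol,
    show (((Matrix.of fun i j => ξ i j).det : ℝ) : ℂ) =
      ((Matrix.of fun i j => ξ i j).map Complex.ofRealHom).det from
      RingHom.map_det Complex.ofRealHom _, ← Matrix.det_mul]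
  congr 1
  ext i k
  rw [Matrix.mul_apply, Matrix.of_apply, diagMap_apply]
  simp [mul_assoc]

/-- The quadratic form `-½ ∑ κⱼ xⱼ²` on `ℝⁿ`. -/
def diagForm (κ : Fin n → ℝ) : QuadraticForm ℝ (RSpace n) :=
  (QuadraticMap.weightedSumSquares ℝ fun j => -(κ j / 2)).comp
    (WithLp.linearEquiv 2 ℝ (Fin n → ℝ)).toLinearMap

theorem diagForm_apply (κ : Fin n → ℝ) (x : RSpace n) :
    diagForm κ x = -∑ j, κ j / 2 * (x j * x j) := by
  simp [diagForm, QuadraticMap.weightedSumSquares_apply]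

theorem polar_diagForm (κ : Fin n → ℝ) (x y : RSpace n) :
    QuadraticMap.polar (diagForm κ) x y = -∑ j, κ j * (x j * y j) := by
  simp only [QuadraticMap.polar, diagForm_apply, PiLp.add_apply, ← Finset.sum_neg_distrib,
    ← Finset.sum_sub_distrib]
  refine Finset.sum_congr rfl fun j _ => ?_
  ring

theorem diagForm_nonpos {κ : Fin n → ℝ} (hκ : ∀ j, 0 ≤ κ j) (x : RSpace n) :
    diagForm κ x ≤ 0 := by
  rw [diagForm_apply, neg_nonpos]
  exact Finset.sum_nonneg fun j _ => mul_nonneg (div_nonneg (hκ j) zero_le_two) (mul_self_nonneg _)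

theorem diagForm_neg {κ : Fin n → ℝ} (hκ : ∀ j, 0 < κ j) {x : RSpace n} (hx : x ≠ 0) :
    diagForm κ x < 0 := by
  rw [diagForm_apply, neg_lt_zero]
  obtain ⟨i, hi⟩ : ∃ i, x i ≠ 0 := by
    by_contra! h
    exact hx (PiLp.ext h)
  exact Finset.sum_pos' (fun j _ => mul_nonneg (half_pos (hκ j)).le (mul_self_nonneg _))
    ⟨i, Finset.mem_univ i, mul_pos (half_pos (hκ i)) (mul_self_pos.2 hi)⟩

/-- The complex factors `rⱼ e^{iαⱼ}` of a diagonal path. -/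
def polarFactor (α r : Fin n → ℝ → ℝ) (t : ℝ) (j : Fin n) : ℂ :=
  r j t * Complex.exp (α j t * Complex.I)

theorem prod_polarFactor (α r : Fin n → ℝ → ℝ) (t : ℝ) :
    ∏ j, polarFactor α r t j =
      ((∏ j, r j t : ℝ) : ℂ) * Complex.exp (((∑ j, α j t : ℝ) : ℂ) * Complex.I) := by
  simp only [polarFactor, Finset.prod_mul_distrib, ← Complex.exp_sum, ← Finset.sum_mul]
  push_cast
  rfl

theorem IsDiagonalGeodesic.polarFactor_ne_zero {θ₀ : ℝ} {α r : Fin n → ℝ → ℝ} {κ : Fin n → ℝ}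
    (hg : IsDiagonalGeodesic θ₀ α r κ) {t : ℝ} (ht : t ∈ Icc (0 : ℝ) 1) (j : Fin n) :
    polarFactor α r t j ≠ 0 :=
  mul_ne_zero (by exact_mod_cast (hg.radius_pos j t ht).ne') (Complex.exp_ne_zero _)

theorem IsDiagonalGeodesic.hasDerivWithinAt_polarFactor {θ₀ : ℝ} {α r : Fin n → ℝ → ℝ}
    {κ : Fin n → ℝ} (hg : IsDiagonalGeodesic θ₀ α r κ) {t : ℝ} (ht : t ∈ Icc (0 : ℝ) 1)
    (j : Fin n) :
    HasDerivWithinAt (fun s => polarFactor α r s j)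
      ((Real.tan (θ₀ + ∑ j, α j t) + Complex.I) * (κ j / r j t ^ 2 : ℝ) * polarFactor α r t j)
      (Icc 0 1) t := by
  refine ((hg.radius_deriv j t ht).ofReal_comp.mul
    (((hg.angle_deriv j t ht).ofReal_comp.mul_const Complex.I).cexp)).congr_deriv ?_
  rw [polarFactor]
  push_cast
  ring

theorem IsDiagonalGeodesic.contDiffOn_polarFactor {θ₀ : ℝ} {α r : Fin n → ℝ → ℝ}
    {κ : Fin n → ℝ} (hg : IsDiagonalGeodesic θ₀ α r κ) (j : Fin n) :
    ContDiffOn ℝ ∞ (fun s => polarFactor α r s j) (Icc 0 1) :=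
  (Complex.ofRealCLM.contDiff.comp_contDiffOn (hg.smooth_radius j)).mul
    ((Complex.ofRealCLM.contDiff.comp_contDiffOn (hg.smooth_angle j)).mul
      contDiffOn_const).cexp

theorem prod_polarFactor_mul_holVol {θ₀ d : ℝ} {u : OrthonormalBasis (Fin n) ℂ (CSpace n)}
    (hd : holVol u = d * Complex.exp (θ₀ * Complex.I)) (α r : Fin n → ℝ → ℝ) (t : ℝ) :
    (∏ j, polarFactor α r t j) * holVol u = (((∏ j, r j t) * d : ℝ) : ℂ) *
      Complex.exp (((θ₀ + ∑ j, α j t : ℝ) : ℂ) * Complex.I) := by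
  rw [prod_polarFactor, hd, Complex.ofReal_add θ₀, add_mul, Complex.exp_add]
  push_cast
  ring

/-- The path of subspaces spanned by the vectors `e^{iαⱼ} uⱼ`, constant outside of `[0, 1]`. -/
def diagPath {θ₀ d : ℝ} {α r : Fin n → ℝ → ℝ} {κ : Fin n → ℝ}
    (hg : IsDiagonalGeodesic θ₀ α r κ) {u : OrthonormalBasis (Fin n) ℂ (CSpace n)} (hd0 : d ≠ 0)
    (hd : holVol u = d * Complex.exp (θ₀ * Complex.I)) (t : ℝ) : LGPos n :=
  ⟨LinearMap.range (diagMap u (polarFactor α r (projIcc 0 1 zero_le_one t))),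
    isLagrangian_range_diagMap u (hg.polarFactor_ne_zero (projIcc 0 1 zero_le_one t).2),
    isPositive_range_diagMap u (by
      rw [prod_polarFactor_mul_holVol hd, Complex.re_ofReal_mul, Complex.exp_ofReal_mul_I_re]
      refine mul_ne_zero (mul_ne_zero (Finset.prod_ne_zero_iff.2 fun j _ =>
        (hg.radius_pos j _ (projIcc 0 1 zero_le_one t).2).ne') hd0) ?_
      exact (Real.cos_pos_of_mem_Ioo (hg.phase_mem _ (projIcc 0 1 zero_le_one t).2)).ne')⟩

/-- The linear lifting `eⱼ ↦ rⱼ e^{iαⱼ} uⱼ` of `diagPath`. -/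
def diagFrames {θ₀ d : ℝ} {α r : Fin n → ℝ → ℝ} {κ : Fin n → ℝ}
    (hg : IsDiagonalGeodesic θ₀ α r κ) {u : OrthonormalBasis (Fin n) ℂ (CSpace n)} (hd0 : d ≠ 0)
    (hd : holVol u = d * Complex.exp (θ₀ * Complex.I)) : Frames (diagPath hg hd0 hd) := fun t =>
  LinearEquiv.ofInjective (diagMap u (polarFactor α r (projIcc 0 1 zero_le_one t)))
    (diagMap_injective u (hg.polarFactor_ne_zero (projIcc 0 1 zero_le_one t).2))

/-! ### Verification of the geodesic equations for diagonal paths -/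

section

variable {θ₀ d : ℝ} {α r : Fin n → ℝ → ℝ} {κ : Fin n → ℝ} (hg : IsDiagonalGeodesic θ₀ α r κ)
  {u : OrthonormalBasis (Fin n) ℂ (CSpace n)} (hd0 : d ≠ 0)
  (hd : holVol u = d * Complex.exp (θ₀ * Complex.I))

theorem diagFrames_apply {t : ℝ} (ht : t ∈ Icc (0 : ℝ) 1) (x : RSpace n) :
    (diagFrames hg hd0 hd t x : CSpace n) = diagMap u (polarFactor α r t) x := by
  conv_rhs => rw [show t = (projIcc 0 1 zero_le_one t : Icc (0 : ℝ) 1) by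
    rw [projIcc_of_mem _ ht]]
  rfl

theorem isLifting_diagFrames : IsLifting (diagFrames hg hd0 hd) := fun x => by
  refine ContDiffOn.congr (f := fun t => diagMap u (polarFactor α r t) x) ?_
    fun t ht => diagFrames_apply hg hd0 hd ht x
  simp only [diagMap_apply]
  exact ContDiffOn.sum fun j _ =>
    (contDiffOn_const.mul (hg.contDiffOn_polarFactor j)).smul contDiffOn_const

theorem liftDeriv_diagFrames {t : ℝ} (ht : t ∈ Icc (0 : ℝ) 1) (x : RSpace n) :
    liftDeriv (diagFrames hg hd0 hd) t x = diagMap u (fun j =>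
      (Real.tan (θ₀ + ∑ j, α j t) + Complex.I) * (κ j / r j t ^ 2 : ℝ) *
        polarFactor α r t j) x := by
  have h : HasDerivWithinAt (fun t => diagMap u (polarFactor α r t) x) (diagMap u (fun j =>
      (Real.tan (θ₀ + ∑ j, α j t) + Complex.I) * (κ j / r j t ^ 2 : ℝ) *
        polarFactor α r t j) x) (Icc 0 1) t := by
    simp only [diagMap_apply]
    exact HasDerivWithinAt.fun_sum fun j _ =>
      ((hg.hasDerivWithinAt_polarFactor ht j).const_mul _).smul_const _
  exact (h.congr (fun s hs => diagFrames_apply hg hd0 hd hs x)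
    (diagFrames_apply hg hd0 hd ht x)).derivWithin (uniqueDiffOn_Icc zero_lt_one t ht)

/-- `Ω` on the subspace is a real multiple of `e^{iθ}`, and `(tan θ + i) e^{iθ}` has real part `tan
θ cos θ - sin θ = 0`. -/
theorem isHorizontalLifting_diagFrames : IsHorizontalLifting (diagFrames hg hd0 hd) := by
  refine ⟨isLifting_diagFrames hg hd0 hd, fun t ht x ξ i => ?_⟩
  rw [liftDeriv_diagFrames hg hd0 hd ht, diagMap_mul_ofReal, holVol_update_smul]
  simp only [diagFrames_apply hg hd0 hd ht]
  set y : RSpace n := WithLp.toLp 2 fun j => κ j / r j t ^ 2 * x j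
  have h : Function.update (fun j => diagMap u (polarFactor α r t) (ξ j)) i
      (diagMap u (polarFactor α r t) y) =
      fun j => diagMap u (polarFactor α r t) (Function.update ξ i y j) := by
    ext1 j
    by_cases hj : j = i
    · subst hj
      simp
    · simp [hj]
  rw [h]
  obtain ⟨c, hc⟩ := holVol_diagMap u (polarFactor α r t) (Function.update ξ i y)
  rw [hc, prod_polarFactor_mul_holVol hd]
  set θ := θ₀ + ∑ j, α j t with hθ
  have hcos := (Real.cos_pos_of_mem_Ioo (hg.phase_mem t ht)).ne'
  rw [← mul_assoc (c : ℂ), ← Complex.ofReal_mul, mul_left_comm, Complex.re_ofReal_mul,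
    Complex.mul_re, Complex.exp_ofReal_mul_I_re, Complex.exp_ofReal_mul_I_im]
  simp only [Complex.add_re, Complex.add_im, Complex.ofReal_re, Complex.ofReal_im, Complex.I_re,
    Complex.I_im, add_zero, zero_add, one_mul]
  rw [Real.tan_mul_cos hcos, sub_self, mul_zero]

/-- The derivative of `diagPath`. -/
def diagField (κ : Fin n → ℝ) {L : ℝ → LGPos n} (Ψ : Frames L) : FieldAlong L := fun t =>
  (diagForm κ).comp (Ψ t).symm.toLinearMap

theorem diagField_apply (κ : Fin n → ℝ) {L : ℝ → LGPos n} (Ψ : Frames L) (t : ℝ)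
    (x : RSpace n) : diagField κ Ψ t (Ψ t x) = diagForm κ x := by
  simp [diagField]

theorem hasDerivative_diagPath :
    HasDerivative (diagPath hg hd0 hd) (diagField κ (diagFrames hg hd0 hd)) := by
  refine ⟨diagFrames hg hd0 hd, isLifting_diagFrames hg hd0 hd, fun t ht x y => ?_⟩
  have h1 : QuadraticMap.polar (diagField κ (diagFrames hg hd0 hd) t)
      (diagFrames hg hd0 hd t x) (diagFrames hg hd0 hd t y) =
      QuadraticMap.polar (diagForm κ) x y := by
    simp only [QuadraticMap.polar, ← map_add, diagField_apply]
  rw [h1, polar_diagForm, liftDeriv_diagFrames hg hd0 hd ht, diagFrames_apply hg hd0 hd ht, symp,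
    inner_diagMap, Complex.im_sum, ← Finset.sum_neg_distrib]
  refine Finset.sum_congr rfl fun j _ => ?_
  have hr := (hg.radius_pos j t ht).ne'
  have h2 : (starRingEnd ℂ) (polarFactor α r t j) * polarFactor α r t j =
      ((r j t ^ 2 : ℝ) : ℂ) := by
    rw [← Complex.normSq_eq_conj_mul_self, Complex.normSq_eq_norm_sq, polarFactor, norm_mul,
      Complex.norm_exp_ofReal_mul_I, Complex.norm_real, mul_one, Real.norm_eq_abs, sq_abs]
  rw [map_mul, map_mul, mul_assoc, h2, Complex.conj_ofReal, mul_assoc, ← Complex.ofReal_mul,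
    Complex.im_ofReal_mul, Complex.im_mul_ofReal]
  simp only [map_add, Complex.conj_ofReal, Complex.conj_I, Complex.add_im, Complex.neg_im,
    Complex.ofReal_im, Complex.I_im]
  field_simp
  ring

/-- In the horizontal frame the derivative is the constant form `diagForm κ`. -/
theorem isGeodesic_diagPath :
    IsGeodesic (diagPath hg hd0 hd) (diagField κ (diagFrames hg hd0 hd)) := by
  refine ⟨hasDerivative_diagPath hg hd0 hd, diagFrames hg hd0 hd,
    isHorizontalLifting_diagFrames hg hd0 hd, fun t _ x => ?_⟩
  simp only [diagField_apply]
  exact hasDerivWithinAt_const t _ _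

theorem diagPath_eq {L : LGPos n} {t : ℝ} (ht : t ∈ Icc (0 : ℝ) 1)
    (h : ∀ j, Complex.exp (α j t * Complex.I) • u j ∈ L.space) : diagPath hg hd0 hd t = L := by
  refine Subtype.ext (range_diagMap_eq u (hg.polarFactor_ne_zero
    (projIcc 0 1 zero_le_one t).2) L.2.1 fun j => ?_)
  rw [projIcc_of_mem _ ht, polarFactor, mul_smul, Complex.coe_smul]
  exact L.space.smul_mem _ (h j)

end

end Geodesic

end PosLag

end

theorem theorem1p5 (n : ℕ) (L₀ L₁ : PosLag.LGPos n) (hm : PosLag.maslovIndex L₀ L₁ = 0) :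
    ∃ (L : ℝ → PosLag.LGPos n) (h : PosLag.FieldAlong L),
      PosLag.IsGeodesic L h ∧ L 0 = L₀ ∧ L 1 = L₁ ∧
      (∀ t ∈ Set.Icc (0 : ℝ) 1, ∀ u : (L t).space, h t u ≤ 0) ∧
      (L₀.space ⊓ L₁.space = ⊥ →
        ∀ t ∈ Set.Icc (0 : ℝ) 1, ∀ u : (L t).space, u ≠ 0 → h t u < 0) := by
  obtain ⟨u, β, hu₀, hβ, hu₁⟩ := PosLag.exists_common_frame L₀.2.1 L₁.2.1
  have hsum : PosLag.phase L₀ + ∑ j, β j = PosLag.phase L₁ := by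
    rw [PosLag.maslovIndex, PosLag.finsum_argSpace hu₀ hβ hu₁, div_eq_zero_iff] at hm
    linarith [hm.resolve_right Real.pi_ne_zero]
  obtain ⟨d, hd0, hd⟩ := PosLag.holVol_unitary_frame L₀ hu₀
  obtain ⟨α, r, κ, hg, hα, hκ, hκ'⟩ := PosLag.exists_diagonalGeodesic (θ₀ := PosLag.phase L₀)
    (fun j => (hβ j).1) (PosLag.phase_mem_Ioo L₀) (hsum ▸ PosLag.phase_mem_Ioo L₁)
  refine ⟨PosLag.diagPath hg hd0 hd, PosLag.diagField κ (PosLag.diagFrames hg hd0 hd),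
    PosLag.isGeodesic_diagPath hg hd0 hd, PosLag.diagPath_eq hg hd0 hd (by simp) fun j => ?_,
    PosLag.diagPath_eq hg hd0 hd (by simp) fun j => ?_, fun t _ v => ?_, fun hinf t _ v hv => ?_⟩
  · simpa [hg.angle_zero j] using hu₀ j
  · rw [hα]
    exact hu₁ j
  · exact PosLag.diagForm_nonpos hκ _
  -- A zero angle would put `u j` into the trivial intersection, so every `β j`, hence every `κ j`,
  -- is positive.
  · refine PosLag.diagForm_neg (fun j => hκ' j ((hβ j).1.lt_of_ne' fun h => ?_))
      fun h => hv ((LinearEquiv.map_eq_zero_iff _).1 h)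
    have h1 := hu₁ j
    rw [h, Complex.ofReal_zero, zero_mul, Complex.exp_zero, one_smul] at h1
    have h2 : u j ∈ L₀.space ⊓ L₁.space := ⟨hu₀ j, h1⟩
    rw [hinf, Submodule.mem_bot] at h2
    exact u.orthonormal.ne_zero j h2
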